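/- Let $\Delta$ be the simplex category and let $\mathbb{F}$ be the skeleton of the category of finite sets with objects $\mathbf{k}=\{1,\dots,k\}$, $k\ge 0$. Let $\Delta_{\mathbb{F}}$ be the category whose objects are pairs $([n], f\colon [n]\to\mathbb{F})$, and whose morphisms $([n],f)\to([m],g)$ are pairs of a map $\phi\colon[n]\to[m]$ in $\Delta$ and a natural transformation $\eta\colon f\to g\circ\phi$ such that every $\eta_i$ is injective and, for all $0\le i\le j\le n$, the naturality square of $\eta$ for $i\le j$ is a pullback square. The projection $\Delta_{\mathbb{F}}\to\Delta$ is the Cartesian fibration corresponding to the functor $X\colon\Delta^{\mathrm{op}}\to\mathrm{Cat}$ that takes $[n]$ to the fibre $X_n=(\Delta_{\mathbb{F}})_{[n]}$ and $\phi\colon[n]\to[m]$ to the functor $X(\phi)=\phi^*\colon X_m\to X_n$ given by composition with $\phi$. Thus $X_n$ is the category of chains $\mathbf{a}_0\to\cdots\to\mathbf{a}_n$ in $\mathbb{F}$, with as morphisms the natural transformations with injective components and Cartesian naturality squares. Let $\Delta_{\mathbb{F}}^\vee\to\Delta^{\mathrm{op}}$ be the projection from the (covariant) Grothendieck construction of the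 same functor $X$. **Proposition.** The projection $\Delta_{\mathbb{F}}^\vee\to\Delta^{\mathrm{op}}$ is an admissible double $\infty$-category. That is: 1. $\Delta_{\mathbb{F}}^\vee\to\Delta^{\mathrm{op}}$ is a coCartesian fibration. 2. The corresponding functor $X$ is a category object: for every $n$ the functor $X_n\to X_1\times_{X_0}\cdots\times_{X_0}X_1$ (with $n$ factors $X_1$, and the fibre product taken in $\infty$-categories, i.e. up to isomorphism), induced by the inclusions $\{i-1,i\}\subseteq[n]$ and $\{j\}\subseteq[n]$, is an equivalence. (For $n=0$ the target is $X_0$.) 3. $X$ is admissible: for every active map $\phi\colon[m]\to[n]$ (that is, $\phi(0)=0$ and $\phi(m)=n$) and every $\xi\in X_m$, the functor $$(X_n)_{\xi/}\longrightarrow\prod_{j=1}^{m}(X_{\phi(j)-\phi(j-1)})_{\xi_j/}$$ is coinitial. Here $\xi_j\in X_1$ is the restriction of $\xi$ to $\{j-1,j\}$; the category $(X_n)_{\xi/}$ has as objects the pairs of $\eta\in X_n$ and a morphism $\xi\to X(\phi)(\eta)$ in $X_m$; the category $(X_{k})_{\xi_j/}$ is defined in the same way, for the active map $[1]\to[k]$;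 and the functor restricts $\eta$ to the intervals $\{\phi(j-1),\dots,\phi(j)\}$. A functor $F\colon C\to D$ of categories is called coinitial if it is so as a functor of $\infty$-categories: for every left fibration $Y\to N(D)$ of simplicial sets, restriction along $N(F)$ is a homotopy equivalence $\mathrm{Map}_{N(D)}(N(D),Y)\to\mathrm{Map}_{N(D)}(N(C),Y)$. -/

import Mathlib

open CategoryTheory MonoidalCategory CartesianMonoidalCategory Opposite
open scoped Simplicial

namespace CompositionProduct

universe v u w

/-! ### Coinitial maps of simplicial sets and coinitial functors -/

/-- A left fibration of simplicial sets: the right lifting property against the horn inclusions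
`Λ[n, i] ⊆ Δ[n]` for `n ≥ 1` and `0 ≤ i < n`. -/
def IsLeftFibration {X T : SSet.{w}} (q : X ⟶ T) : Prop :=
  ∀ (n : ℕ) (i : Fin (n + 2)), i < Fin.last (n + 1) →
    HasLiftingProperty (SSet.horn.{w} (n + 1) i).ι q

/-- The simplicial set `Map_T(S, X)` of maps from `f : S ⟶ T` to `q : X ⟶ T` over `T`. Its
`n`-simplices are the maps `S × Δ[n] ⟶ X` over `T`. -/
def mapOver {S X T : SSet.{w}} (f : S ⟶ T) (q : X ⟶ T) : SSet.{w} where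
  obj n := {σ : S ⊗ SSet.stdSimplex.obj n.unop ⟶ X // σ ≫ q = fst _ _ ≫ f}
  map a := ↾fun σ => ⟨S ◁ SSet.stdSimplex.map a.unop ≫ σ.1, by
    rw [Category.assoc, σ.2, whiskerLeft_fst_assoc]⟩
  map_id n := by
    refine ConcreteCategory.hom_ext _ _ fun σ => Subtype.ext ?_
    exact (congrArg (fun t => S ◁ t ≫ σ.1)
      (CategoryTheory.Functor.map_id SSet.stdSimplex n.unop)).trans (by simp)
  map_comp a b := by
    refine ConcreteCategory.hom_ext _ _ fun σ => Subtype.ext ?_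
    exact (congrArg (fun t => S ◁ t ≫ σ.1)
      (CategoryTheory.Functor.map_comp SSet.stdSimplex b.unop a.unop)).trans
        (by rw [MonoidalCategory.whiskerLeft_comp, Category.assoc]; rfl)

/-- Precomposition with `f : S ⟶ T`, as a map `Map_T(T, X) ⟶ Map_T(S, X)`. -/
def mapOverRestrict {S X T : SSet.{w}} (f : S ⟶ T) (q : X ⟶ T) :
    mapOver (𝟙 T) q ⟶ mapOver f q where
  app n := ↾fun σ => ⟨f ▷ SSet.stdSimplex.obj n.unop ≫ σ.1, by
    rw [Category.assoc, σ.2, whiskerRight_fst_assoc, Category.comp_id]⟩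
  naturality _ _ a := by
    refine ConcreteCategory.hom_ext _ _ fun σ => Subtype.ext ?_
    exact (whisker_exchange_assoc f (SSet.stdSimplex.map a.unop) σ.1).symm

/-- Two maps of simplicial sets are homotopic if they are joined by a zigzag of simplicial
homotopies. (When the target is a Kan complex, a single homotopy suffices.) -/
def Homotopic {A B : SSet.{w}} (f g : A ⟶ B) : Prop :=
  Relation.EqvGen (fun f' g' : A ⟶ B => Nonempty (SSet.Homotopy f' g')) f g

/-- Homotopy equivalences of simplicial sets. -/
def IsHomotopyEquivalence {A B : SSet.{w}} (f : A ⟶ B) : Prop :=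
  ∃ g : B ⟶ A, Homotopic (f ≫ g) (𝟙 A) ∧ Homotopic (g ≫ f) (𝟙 B)

/-- A map `f : S ⟶ T` of simplicial sets is coinitial (that is, its opposite is cofinal in the
sense of Joyal and Lurie) if for every left fibration `q : X ⟶ T` the restriction map
`Map_T(T, X) ⟶ Map_T(S, X)` is a homotopy equivalence. -/
def IsCoinitialMap {S T : SSet.{w}} (f : S ⟶ T) : Prop :=
  ∀ (X : SSet.{w}) (q : X ⟶ T), IsLeftFibration q → IsHomotopyEquivalence (mapOverRestrict f q)

/-- A functor of ordinary categories is coinitial, as a functor of `∞`-categories, if the map it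
induces on nerves is coinitial. -/
def IsCoinitial {C D : Type u} [Category.{v} C] [Category.{v} D] (F : C ⥤ D) : Prop :=
  IsCoinitialMap (nerveMap F)

/-! ### CoCartesian fibrations, category objects and admissibility -/

/-- CoCartesian fibrations (Grothendieck opfibrations) of ordinary categories. -/
def IsCocartesianFibration {M : Type*} {B : Type*} [Category* M] [Category* B] (p : M ⥤ B) :
    Prop :=
  ∀ (a : M) {S : B} (f : p.obj a ⟶ S), ∃ (b : M) (φ : a ⟶ b), p.IsStronglyCocartesian f φ

section SimplicialCategories

variable (X : SimplexCategoryᵒᵖ ⥤ Cat.{v, u})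

/-- The functor `X(φ) : X_m ⥤ X_n` for `φ : [n] ⟶ [m]`. -/
abbrev reindex {a b : SimplexCategory} (φ : a ⟶ b) : X.obj (op b) ⥤ X.obj (op a) :=
  (X.map φ.op).toFunctor

/-- A commutative square in the simplex category gives a commutative square of categories. -/
def reindexSquare {a b b' c : SimplexCategory} {f : a ⟶ b} {g : b ⟶ c} {f' : a ⟶ b'} {g' : b' ⟶ c}
    (h : f ≫ g = f' ≫ g') :
    reindex X g ⋙ reindex X f ≅ reindex X g' ⋙ reindex X f' :=
  eqToIso (by
    simp only [reindex, ← Cat.Hom.comp_toFunctor, ← Functor.map_comp, ← op_comp, h])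

/-- Objects of the iterated (homotopy) fibre product `X_1 ×_{X_0} ⋯ ×_{X_0} X_1` with `k + 1`
factors, formed in the `2`-category of categories: objects of `X_1` together with isomorphisms
in `X_0` from the target of each one to the source of the next. -/
structure SegalChain (k : ℕ) where
  /-- the `k + 1` objects of `X_1` -/
  edge : Fin (k + 1) → X.obj (op ⦋1⦌)
  /-- the gluing isomorphisms in `X_0` -/
  glue : ∀ j : Fin k,
    (reindex X (SimplexCategory.δ (0 : Fin 2))).obj (edge j.castSucc) ≅
      (reindex X (SimplexCategory.δ (1 : Fin 2))).obj (edge j.succ)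

namespace SegalChain

variable {X} {k : ℕ}

/-- Morphisms of the iterated fibre product: families of morphisms of `X_1` compatible with the
gluing isomorphisms. -/
@[ext]
structure Hom (A B : SegalChain X k) where
  /-- the components -/
  map : ∀ i, A.edge i ⟶ B.edge i
  comm : ∀ j : Fin k,
    (reindex X (SimplexCategory.δ (0 : Fin 2))).map (map j.castSucc) ≫ (B.glue j).hom =
      (A.glue j).hom ≫ (reindex X (SimplexCategory.δ (1 : Fin 2))).map (map j.succ)

instance : Category (SegalChain X k) where
  Hom := Hom
  id A := { map := fun i => 𝟙 (A.edge i), comm := fun j => by simp }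
  comp f g :=
    { map := fun i => f.map i ≫ g.map i
      comm := fun j => by
        rw [Functor.map_comp, Functor.map_comp, Category.assoc, g.comm, ← Category.assoc, f.comm,
          Category.assoc] }
  id_comp f := Hom.ext (funext fun i => Category.id_comp (f.map i))
  comp_id f := Hom.ext (funext fun i => Category.comp_id (f.map i))
  assoc f g h := Hom.ext (funext fun i => Category.assoc (f.map i) (g.map i) (h.map i))

end SegalChain

/-- In the simplex category, the target `{j + 1}` of the edge `{j, j + 1}` is the source of the
edge `{j + 1, j + 2}`. -/
theorem vertex_eq {k : ℕ} (j : Fin k) :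
    SimplexCategory.δ (0 : Fin 2) ≫ SimplexCategory.mkOfSucc j.castSucc =
      SimplexCategory.δ (1 : Fin 2) ≫ SimplexCategory.mkOfSucc j.succ := by
  rw [SimplexCategory.δ_zero_mkOfSucc, SimplexCategory.δ_one_mkOfSucc, Fin.succ_castSucc]

/-- The Segal functor `X_{k + 1} ⥤ X_1 ×_{X_0} ⋯ ×_{X_0} X_1`, induced by the inclusions
`{i, i + 1} ⊆ [k + 1]` and `{j} ⊆ [k + 1]`. -/
def segalFunctor (k : ℕ) : X.obj (op ⦋k + 1⦌) ⥤ SegalChain X k where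
  obj ξ :=
    { edge := fun i => (reindex X (SimplexCategory.mkOfSucc i)).obj ξ
      glue := fun j => (reindexSquare X (vertex_eq j)).app ξ }
  map f :=
    { map := fun i => (reindex X (SimplexCategory.mkOfSucc i)).map f
      comm := fun j => (reindexSquare X (vertex_eq j)).hom.naturality f }
  map_id _ := SegalChain.Hom.ext (funext fun _ => CategoryTheory.Functor.map_id _ _)
  map_comp _ _ := SegalChain.Hom.ext (funext fun _ => Functor.map_comp _ _ _)

/-- A simplicial category `X` is a category object in `∞`-categories if the Segal functors
`X_n ⥤ X_1 ×_{X_0} ⋯ ×_{X_0} X_1` are equivalences for all `n ≥ 1`. (For `n = 0` the condition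
reads `X_0 ≃ X_0`.) -/
def IsCategoryObject : Prop :=
  ∀ k : ℕ, (segalFunctor X k).IsEquivalence

variable {m n : ℕ}

/-- A map of the simplex category is active if it preserves the end points. -/
def IsActive (φ : ⦋m⦌ ⟶ ⦋n⦌) : Prop :=
  φ.toOrderHom 0 = 0 ∧ φ.toOrderHom (Fin.last m) = Fin.last n

/-- The number `φ(j + 1) - φ(j)`, for `0 ≤ j < m`. -/
def gap (φ : ⦋m⦌ ⟶ ⦋n⦌) (j : Fin m) : ℕ :=
  (φ.toOrderHom j.succ : ℕ) - (φ.toOrderHom j.castSucc : ℕ)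

/-- As `φ` is monotone, the subtraction in `gap` is not truncated. -/
theorem add_gap (φ : ⦋m⦌ ⟶ ⦋n⦌) (j : Fin m) :
    (φ.toOrderHom j.castSucc : ℕ) + gap φ j = (φ.toOrderHom j.succ : ℕ) :=
  Nat.add_sub_cancel' (φ.toOrderHom.monotone (Fin.castSucc_le_succ j))

/-- The inclusion of the interval `{φ(j), …, φ(j + 1)}` in `[n]`. -/
def piece (φ : ⦋m⦌ ⟶ ⦋n⦌) (j : Fin m) : ⦋gap φ j⦌ ⟶ ⦋n⦌ :=
  SimplexCategory.subinterval (φ.toOrderHom j.castSucc : ℕ) (gap φ j)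
    ((add_gap φ j).trans_le (Nat.lt_succ_iff.mp (φ.toOrderHom j.succ).isLt))

/-- The restriction of `φ` to `{j, j + 1}` factors as the active map `[1] ⟶ [φ(j + 1) - φ(j)]`
followed by the inclusion of the interval `{φ(j), …, φ(j + 1)}`. -/
theorem piece_eq (φ : ⦋m⦌ ⟶ ⦋n⦌) (j : Fin m) :
    SimplexCategory.mkOfSucc j ≫ φ = SimplexCategory.diag (gap φ j) ≫ piece φ j := by
  rw [piece, SimplexCategory.diag_subinterval_eq]
  refine SimplexCategory.Hom.ext_one_left _ _ rfl ?_
  exact Fin.ext (add_gap φ j).symm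

/-- For `φ : [m] ⟶ [n]`, `ξ ∈ X_m` and `0 ≤ j < m`, the functor from `(X_n)_{ξ/}` (pairs of an
object `η` of `X_n` and a morphism `ξ ⟶ X(φ) η`) to `(X_{φ(j + 1) - φ(j)})_{ξ_j/}` obtained by
restricting `η` to `{φ(j), …, φ(j + 1)}`; here `ξ_j` is the restriction of `ξ` to
`{j, j + 1}`. -/
def comparisonComponent (φ : ⦋m⦌ ⟶ ⦋n⦌) (ξ : X.obj (op ⦋m⦌)) (j : Fin m) :
    StructuredArrow ξ (reindex X φ) ⥤
      StructuredArrow ((reindex X (SimplexCategory.mkOfSucc j)).obj ξ)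
        (reindex X (SimplexCategory.diag (gap φ j))) :=
  StructuredArrow.map₂ (F := reindex X (piece φ j)) (G := reindex X (SimplexCategory.mkOfSucc j))
    (𝟙 _) (reindexSquare X (piece_eq φ j)).hom

/-- The comparison functor `(X_n)_{ξ/} ⥤ ∏_j (X_{φ(j + 1) - φ(j)})_{ξ_j/}`. -/
def comparison (φ : ⦋m⦌ ⟶ ⦋n⦌) (ξ : X.obj (op ⦋m⦌)) :
    StructuredArrow ξ (reindex X φ) ⥤
      ∀ j : Fin m, StructuredArrow ((reindex X (SimplexCategory.mkOfSucc j)).obj ξ)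
        (reindex X (SimplexCategory.diag (gap φ j))) :=
  Functor.pi' (comparisonComponent X φ ξ)

/-- A simplicial category is admissible if all comparison functors for active maps are
coinitial. -/
def IsAdmissible : Prop :=
  ∀ (m n : ℕ) (φ : ⦋m⦌ ⟶ ⦋n⦌), IsActive φ → ∀ ξ : X.obj (op ⦋m⦌), IsCoinitial (comparison X φ ξ)

end SimplicialCategories

/-! ### Barwick's category `Δ_𝔽` and its dual -/

/-- Chains `a_0 ⟶ ⋯ ⟶ a_n` in the skeleton `𝔽` of the category of finite sets, that is,
functors `[n] ⥤ 𝔽`. -/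
structure FinChain (n : SimplexCategory) where
  /-- the underlying functor -/
  functor : Fin (n.len + 1) ⥤ FintypeCat.Skeleton.{0}

namespace FinChain

/-- Morphisms of chains: natural transformations whose components are injective and whose
naturality squares are Cartesian. -/
@[ext]
structure Hom {n : SimplexCategory} (A B : FinChain n) where
  /-- the underlying natural transformation -/
  nat : A.functor ⟶ B.functor
  injective : ∀ i, Function.Injective (nat.app i : _ → _)
  isPullback : ∀ (i j : Fin (n.len + 1)) (h : i ≤ j),
    IsPullback (A.functor.map (homOfLE h)) (nat.app i) (nat.app j) (B.functor.map (homOfLE h))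

instance (n : SimplexCategory) : Category (FinChain n) where
  Hom := Hom
  id A :=
    { nat := 𝟙 A.functor
      injective := fun _ => Function.injective_id
      isPullback := fun _ _ _ => IsPullback.of_vert_isIso ⟨by simp⟩ }
  comp f g :=
    { nat := f.nat ≫ g.nat
      injective := fun i => (g.injective i).comp (f.injective i)
      isPullback := fun i j h => (f.isPullback i j h).paste_vert (g.isPullback i j h) }
  id_comp f := Hom.ext (Category.id_comp f.nat)
  comp_id f := Hom.ext (Category.comp_id f.nat)
  assoc f g h := Hom.ext (Category.assoc f.nat g.nat h.nat)

/-- The reindexing functor `φ^*` along `φ : [n] ⟶ [m]`, given by composition with `φ`. -/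
def pull {n m : SimplexCategory} (φ : n ⟶ m) : FinChain m ⥤ FinChain n where
  obj A := ⟨φ.toOrderHom.monotone.functor ⋙ A.functor⟩
  map f :=
    { nat := Functor.whiskerLeft φ.toOrderHom.monotone.functor f.nat
      injective := fun i => f.injective (φ.toOrderHom i)
      isPullback := fun i j h => f.isPullback _ _ (φ.toOrderHom.monotone h) }

end FinChain

/-- Objects of Barwick's category `Δ_𝔽`: pairs of `[n]` and a functor `[n] ⥤ 𝔽`. -/
structure DeltaF where
  /-- the object `[n]` -/
  base : SimplexCategory
  /-- the functor `[n] ⥤ 𝔽` -/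
  chain : FinChain base

namespace DeltaF

/-- Morphisms `([n], f) ⟶ ([m], g)` of `Δ_𝔽`: a map `φ : [n] ⟶ [m]` together with a natural
transformation `f ⟶ g ∘ φ` with injective components and Cartesian naturality squares. -/
structure Hom (I J : DeltaF) where
  /-- the map `φ` -/
  base : I.base ⟶ J.base
  /-- the natural transformation -/
  chain : I.chain ⟶ (FinChain.pull base).obj J.chain

theorem Hom.ext {I J : DeltaF} {f g : Hom I J} (h : f.base = g.base)
    (h' : f.chain ≫ eqToHom (by rw [h]) = g.chain) : f = g := by
  obtain ⟨φ, η⟩ := f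
  obtain ⟨ψ, θ⟩ := g
  obtain rfl : φ = ψ := h
  obtain rfl : η = θ := (Category.comp_id η).symm.trans h'
  rfl

instance : Category DeltaF where
  Hom := Hom
  id I := ⟨𝟙 I.base, 𝟙 I.chain⟩
  comp f g := ⟨f.base ≫ g.base, f.chain ≫ (FinChain.pull f.base).map g.chain⟩
  id_comp f := Hom.ext (Category.id_comp f.base) rfl
  comp_id f := Hom.ext (Category.comp_id f.base) rfl
  assoc f g h := Hom.ext (Category.assoc f.base g.base h.base) rfl

/-- The projection `Δ_𝔽 ⥤ Δ`. By the shape of the morphisms of `Δ_𝔽`, it is the Cartesian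
fibration given by the functor `DeltaF.fibre`. -/
def proj : DeltaF ⥤ SimplexCategory where
  obj I := I.base
  map f := Hom.base f

/-- The functor `Δᵒᵖ ⥤ Cat` corresponding to `Δ_𝔽 ⥤ Δ`: it takes `[n]` to the fibre over `[n]`,
the category of chains of length `n`, and `φ` to the reindexing functor `φ^*`. -/
def fibre : SimplexCategoryᵒᵖ ⥤ Cat.{0, 0} where
  obj n := Cat.of (FinChain n.unop)
  map φ := (FinChain.pull φ.unop).toCatHom

end DeltaF

/-- The category `Δ_𝔽^∨`, whose projection to `Δᵒᵖ` is the coCartesian fibration corresponding to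
the same functor `Δᵒᵖ ⥤ Cat` as the Cartesian fibration `Δ_𝔽 ⥤ Δ`. It has the same objects as
`Δ_𝔽`, and a morphism from `([m], g)` to `([n], f)` is a map `φ : [n] ⟶ [m]` together with a
morphism of chains `g ∘ φ ⟶ f`. -/
abbrev DeltaFDual : Type := Grothendieck DeltaF.fibre

/-- The projection `Δ_𝔽^∨ ⥤ Δᵒᵖ`. -/
abbrev DeltaFDual.proj : DeltaFDual ⥤ SimplexCategoryᵒᵖ := Grothendieck.forget DeltaF.fibre

end CompositionProduct

/-!
# The category `Δ_𝔽` gives an admissible double `∞`-category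

The fibre `X_n` consists of chains of finite sets, and it is handled throughout in terms of
elements: a morphism of chains is a family of injections which commutes with the maps of the chains
and along which elements can be pulled back (`FinChain.homMk`). Both conditions need to be checked
on consecutive sets only (`FinChain.homMkSucc`), which gives the Segal condition
(`DeltaF.isCategoryObject_fibre`). That the Grothendieck construction is a coCartesian fibration is
general (`isCocartesianFibration_forget`).

For admissibility, let `φ : [m] ⟶ [n]` be active and `ξ` in `X_m`, and call an object `η` of
`(X_n)_{ξ/}` *tight* if `ξ ⟶ φ^* η` is an isomorphism. The category `(X_n)_{ξ/}` coreflects onto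
its tight objects, and so does the product of the categories `(X_{φ(j + 1) - φ(j)})_{ξ_j/}`: by the
Cartesian condition a chain can be restricted to any subset of its last set, and restricting it to
the image of the last set of `ξ_j` gives a tight object. The
comparison functor is fully faithful on morphisms out of tight objects, because all sets of a chain
over `[n]` either lie over a vertex in the image of `φ`, where a morphism is determined by `ξ`, or
inside a unique piece (`FinChain.exists_glue`, `FinChain.glue_unique`). It is essentially
surjective on tight objects, because tight chains on the pieces can be glued along `ξ`
(`FinChain.exists_glue_chain`). So every object of the product has a coreflection from the image of
a tight object (`DeltaF.exists_coreflection`), the comparison functor `F` has, up to natural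
transformations `G ⋙ F ⟶ 𝟭` and `F ⋙ G ⟶ 𝟭` compatible with `F`, an inverse `G`, and it remains
to see that such a functor is coinitial.

On nerves, these natural transformations are simplicial homotopies `H` and `K` which start at the
composites of the two maps, end at the identities and are compatible with the map in question
(`isCoinitialMap_of_homotopies`). Given a left fibration `X ⟶ T`, sections over `S` are pulled back
along `T ⟶ S` and transported along `H`. The transport exists, and is unique up to homotopy,
because a left fibration has the right lifting property against `Z × {0} ⊆ Z × Δ[1]` and its
relative versions (`IsLeftFibration.exists_lift`, `IsLeftFibration.exists_homotopy`); this comes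
from the pairing by which Mathlib shows that the pushout-product of a horn inclusion and a boundary
inclusion is anodyne, since for a left horn that pairing fills left horns only.
-/

namespace CompositionProduct

universe v u w

/-! ### Left anodyne maps and the covering homotopy property of left fibrations -/

section LeftAnodyne

open MonoidalClosed Limits SSet

/-- The left horn inclusions `Λ[n, i] ⊆ Δ[n]`, for `n ≥ 1` and `0 ≤ i < n`. -/
def leftHornInclusions : MorphismProperty SSet.{w} :=
  ⨆ n, .ofHoms (fun (i : Fin (n + 1)) ↦ Λ[n + 1, i.castSucc].ι)

/-- A map of simplicial sets is left anodyne if it has the left lifting property against all left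
fibrations. -/
def leftAnodyne : MorphismProperty SSet.{w} := leftHornInclusions.rlp.llp
deriving MorphismProperty.IsMultiplicative, MorphismProperty.RespectsIso,
  MorphismProperty.IsStableUnderCobaseChange, MorphismProperty.IsStableUnderRetracts,
  MorphismProperty.IsStableUnderTransfiniteComposition,
  MorphismProperty.IsStableUnderCoproducts

lemma horn_ι_mem_leftHornInclusions (n : ℕ) (i : Fin (n + 1)) :
    leftHornInclusions.{w} Λ[n + 1, i.castSucc].ι := by
  simp only [leftHornInclusions, MorphismProperty.iSup_iff]
  exact ⟨n, ⟨i⟩⟩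

lemma isLeftFibration_iff {X T : SSet.{w}} (q : X ⟶ T) :
    IsLeftFibration q ↔ leftHornInclusions.rlp q := by
  refine ⟨fun h A B f hf ↦ ?_, fun h n i hi ↦ ?_⟩
  · simp only [leftHornInclusions, MorphismProperty.iSup_iff] at hf
    obtain ⟨n, ⟨i⟩⟩ := hf
    exact h n i.castSucc (Fin.castSucc_lt_last i)
  · obtain ⟨i, rfl⟩ := Fin.eq_castSucc_of_ne_last (Fin.ne_last_of_lt hi)
    exact h _ (horn_ι_mem_leftHornInclusions n i)

lemma leftAnodyne_horn_ι (n : ℕ) (i : Fin (n + 1)) :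
    leftAnodyne.{w} Λ[n + 1, i.castSucc].ι :=
  MorphismProperty.le_llp_rlp _ _ (horn_ι_mem_leftHornInclusions n i)

attribute [local instance] Cardinal.fact_isRegular_aleph0
  Cardinal.orderBotAleph0OrdToType

/-- A subcomplex inclusion with a regular pairing whose distinguished faces are never the last
ones is obtained by filling left horns. -/
lemma leftAnodyne_of_pairing {X : SSet.{w}} {A : X.Subcomplex} (P : A.Pairing) [P.IsRegular]
    (hP : ∀ (x : P.II) {d : ℕ} (hd : x.1.dim = d),
      (P.isUniquelyCodimOneFace x).index hd ≠ Fin.last _) :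
    leftAnodyne A.ι :=
  MorphismProperty.transfiniteCompositionsOfShape_le _ _ _
    ⟨P.rankFunction.relativeCellComplex.toTransfiniteCompositionOfShape, fun j hj ↦ by
      refine (?_ : (_ : MorphismProperty _) ≤ _ ) _
        (P.rankFunction.relativeCellComplex.attachCells j hj).pushouts_coproducts
      simp only [MorphismProperty.pushouts_le_iff, MorphismProperty.coproducts_le_iff]
      rintro _ _ _ ⟨c⟩
      have hn := hP c.s rfl
      obtain ⟨i, hi⟩ := Fin.eq_castSucc_of_ne_last hn
      have h := leftAnodyne_horn_ι.{w} _ i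
      rw [hi] at h
      exact h⟩

/-- The pairing that Mathlib constructs for the inclusion of
`Λ[m + 1, k] ⊗ Δ[n] ∪ Δ[m + 1] ⊗ ∂Δ[n]` fills left horns only when `k` is not the last vertex. -/
lemma leftAnodyne_unionProd_ι {m : ℕ} (k : Fin (m + 1)) (n : ℕ) :
    leftAnodyne (Subcomplex.unionProd.{w} Λ[m + 1, k.castSucc] ∂Δ[n]).ι := by
  refine leftAnodyne_of_pairing (prodStdSimplex.pairingCore k n).pairing ?_
  intro x d hd
  obtain ⟨s, rfl⟩ := (prodStdSimplex.pairingCore k n).equivII.surjective x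
  subst hd
  intro h
  have key : ∀ (y : Subcomplex.N _) (_ : y = (prodStdSimplex.pairingCore k n).type₁ s)
      (hu : S.IsUniquelyCodimOneFace ((prodStdSimplex.pairingCore k n).type₂ s).toS y.toS),
      hu.index rfl ≠ Fin.last _ := by
    rintro _ rfl hu hl
    have h1 := (prodStdSimplex.pairingCore k n).isUniquelyCodimOneFace_index s
    have h2 := h1.symm.trans hl
    exact (Fin.castSucc_lt_last s.index).ne h2
  exact key _ ((prodStdSimplex.pairingCore k n).type₁_pairing s).symm _ h

variable {X₁ X₂ Y₁ Y₂ E B : SSet.{w}} {i : X₁ ⟶ Y₁} {j : X₂ ⟶ Y₂} {p : E ⟶ B}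

/-- The pullback-power of a left fibration by a monomorphism is a left fibration. By adjunction this
reduces to the pushout-products of left horn inclusions and boundary inclusions. -/
lemma IsLeftFibration.pullbackObjObjπ [Mono i] (hp : IsLeftFibration p)
    (sq₁₃ : MonoidalClosed.internalHom.PullbackObjObj i p) :
    IsLeftFibration sq₁₃.π := by
  rw [isLeftFibration_iff] at hp ⊢
  intro _ _ _ h
  simp only [leftHornInclusions, MorphismProperty.iSup_iff] at h
  obtain ⟨m, ⟨k⟩⟩ := h
  let sq₁₂ := Functor.PushoutObjObj.ofHasPushout (curriedTensor SSet) i Λ[m + 1, k.castSucc].ι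
  rw [← internalHomAdjunction₂.hasLiftingProperty_iff sq₁₂]
  suffices leftAnodyne sq₁₂.ι from this _ hp
  intro E B p hp
  rw [HasLiftingProperty.iff_of_arrow_iso_left
    (show Arrow.mk sq₁₂.ι ≅ Arrow.mk sq₁₂.flipTensor.ι from
      Arrow.isoMk (Iso.refl _) (β_ _ _))]
  let sq₁₃' := Functor.PullbackObjObj.ofHasPullback MonoidalClosed.internalHom
    Λ[m + 1, k.castSucc].ι p
  rw [internalHomAdjunction₂.hasLiftingProperty_iff _ sq₁₃']
  suffices (MorphismProperty.monomorphisms _).rlp sq₁₃'.π from this _ inferInstance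
  rw [rlp_monomorphisms]
  rintro _ _ _ ⟨n⟩
  rw [← internalHomAdjunction₂.hasLiftingProperty_iff
    (Subcomplex.unionProd.pushoutObjObj.{w} _ _),
    Subcomplex.unionProd.pushoutObjObj_ι]
  exact leftAnodyne_unionProd_ι _ _ _ hp

lemma leftAnodyne_pushoutObjObjι
    (sq₁₂ : (curriedTensor _).PushoutObjObj i j) [Mono i] (hj : leftAnodyne j) :
    leftAnodyne sq₁₂.ι := by
  intro E B p hp
  let sq₁₃ := Functor.PullbackObjObj.ofHasPullback MonoidalClosed.internalHom i p
  rw [internalHomAdjunction₂.hasLiftingProperty_iff _ sq₁₃]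
  apply hj
  rw [← isLeftFibration_iff] at hp ⊢
  exact hp.pullbackObjObjπ sq₁₃

/-- The horn `Λ[1, 0]` is the initial vertex of `Δ[1]`. -/
lemma whiskerLeft_horn_ι (Z : SSet.{w}) :
    Z ◁ (Λ[1, 0] : (Δ[1] : SSet.{w}).Subcomplex).ι = fst _ _ ≫ ι₀ := by
  refine NatTrans.ext (funext fun ⟨n⟩ ↦ ConcreteCategory.hom_ext _ _ fun ⟨z, s, hs⟩ ↦ ?_)
  induction n using SimplexCategory.rec with | _ n
  refine Prod.ext rfl ?_
  refine DFunLike.ext (F := (Δ[1] : SSet.{w}) _⦋n⦌) _ _ fun k ↦ ?_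
  rw [mem_horn_iff_notMem_range] at hs
  obtain ⟨i, hi, hi'⟩ := hs
  change s k = 0
  have h1 : i = 1 := by
    fin_cases i
    · exact (hi rfl).elim
    · rfl
  subst h1
  have h2 : s k ≠ 1 := fun h ↦ hi' ⟨k, h⟩
  omega

/-- Relative covering homotopies: homotopies can be lifted along a left fibration from their
starting points, compatibly with a given lift on a simplicial subset. -/
lemma IsLeftFibration.exists_relative_lift {A Z X T : SSet.{w}} {q : X ⟶ T}
    (hq : IsLeftFibration q) (j : A ⟶ Z) [Mono j] (a : A ⊗ Δ[1] ⟶ X) (b : Z ⟶ X)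
    (h : Z ⊗ Δ[1] ⟶ T) (hab : ι₀ ≫ a = j ≫ b) (ha : a ≫ q = j ▷ _ ≫ h) (hb : b ≫ q = ι₀ ≫ h) :
    ∃ L : Z ⊗ Δ[1] ⟶ X, j ▷ _ ≫ L = a ∧ ι₀ ≫ L = b ∧ L ≫ q = h := by
  let sq := Functor.PushoutObjObj.ofHasPushout (curriedTensor SSet) j
    (Λ[1, 0] : (Δ[1] : SSet.{w}).Subcomplex).ι
  have hA : leftAnodyne sq.ι := leftAnodyne_pushoutObjObjι sq (leftAnodyne_horn_ι 0 0)
  have : HasLiftingProperty sq.ι q := hA _ ((isLeftFibration_iff q).1 hq)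
  have w : j ▷ _ ≫ (fst Z (Λ[1, 0] : SSet.{w}) ≫ b) =
      A ◁ (Λ[1, 0] : (Δ[1] : SSet.{w}).Subcomplex).ι ≫ a := by
    rw [whiskerLeft_horn_ι, Category.assoc, hab, whiskerRight_fst_assoc]
  let u : sq.pt ⟶ X := sq.isPushout.desc (fst Z (Λ[1, 0] : SSet.{w}) ≫ b) a w
  have hu₁ : sq.inl ≫ u = fst Z (Λ[1, 0] : SSet.{w}) ≫ b := sq.isPushout.inl_desc _ _ _
  have hu₂ : sq.inr ≫ u = a := sq.isPushout.inr_desc _ _ _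
  have hs₁ : sq.inl ≫ sq.ι = Z ◁ (Λ[1, 0] : (Δ[1] : SSet.{w}).Subcomplex).ι := sq.inl_ι
  have hs₂ : sq.inr ≫ sq.ι = j ▷ _ := sq.inr_ι
  have comm : CommSq u sq.ι q h := ⟨by
    apply sq.hom_ext
    · rw [reassoc_of% hu₁, reassoc_of% hs₁, hb, whiskerLeft_horn_ι, Category.assoc]
    · rw [reassoc_of% hu₂, reassoc_of% hs₂, ha]⟩
  refine ⟨comm.lift, ?_, ?_, comm.fac_right⟩
  · rw [← hs₂, Category.assoc, comm.fac_left, hu₂]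
  · -- the initial vertex as a map to the horn
    let c : Z ⟶ (Λ[1, 0] : SSet.{w}) := Subcomplex.lift (const (stdSimplex.obj₀Equiv.symm 0)) (by
      rintro ⟨n⟩ _ ⟨z, rfl⟩
      induction n using SimplexCategory.rec with | _ n
      rw [mem_horn_iff_notMem_range]
      refine ⟨1, one_ne_zero, ?_⟩
      rintro ⟨k, hk⟩
      exact zero_ne_one (α := Fin 2) hk)
    have hc : lift (𝟙 Z) c ≫ sq.inl ≫ sq.ι = ι₀ := by
      rw [hs₁, lift_whiskerLeft]
      rfl
    rw [← hc, Category.assoc, Category.assoc, comm.fac_left, hu₁, lift_fst_assoc, Category.id_comp]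

/-- Homotopies lift along a left fibration from their starting points. -/
lemma IsLeftFibration.exists_lift {Z X T : SSet.{w}} {q : X ⟶ T}
    (hq : IsLeftFibration q) (b : Z ⟶ X) (h : Z ⊗ Δ[1] ⟶ T) (hb : b ≫ q = ι₀ ≫ h) :
    ∃ L : Z ⊗ Δ[1] ⟶ X, ι₀ ≫ L = b ∧ L ≫ q = h := by
  let a : ((⊥ : Z.Subcomplex) : SSet.{w}) ⊗ Δ[1] ⟶ X :=
    { app n := ↾fun x ↦ x.1.2.elim
      naturality n m f := ConcreteCategory.hom_ext _ _ fun x ↦ x.1.2.elim }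
  obtain ⟨L, -, h₀, hL⟩ := hq.exists_relative_lift (⊥ : Z.Subcomplex).ι a b h
    (NatTrans.ext (funext fun n ↦ ConcreteCategory.hom_ext _ _ fun x ↦ x.2.elim))
    (NatTrans.ext (funext fun n ↦ ConcreteCategory.hom_ext _ _ fun x ↦ x.1.2.elim)) hb
  exact ⟨L, h₀, hL⟩

/-- The two ends of a cylinder are disjoint. -/
lemma ι₀_app_ne_ι₁_app {Z : SSet.{w}} {n : SimplexCategoryᵒᵖ} (z z' : Z.obj n) :
    ι₀.app n z ≠ ι₁.app n z' := by
  obtain ⟨n⟩ := n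
  induction n using SimplexCategory.rec with | _ n
  intro h
  have h2 := congrArg (fun x : (Z ⊗ Δ[1] : SSet.{w}).obj (op ⦋n⦌) ↦ x.2) h
  have h3 : (0 : Fin 2) = 1 := DFunLike.congr_fun h2 (0 : Fin (n + 1))
  exact zero_ne_one h3

/-- Two lifts of the same homotopy along a left fibration with the same starting point have
homotopic end points, by a homotopy over the base. -/
lemma IsLeftFibration.exists_homotopy {Z X T : SSet.{w}} {q : X ⟶ T}
    (hq : IsLeftFibration q) (L L' : Z ⊗ Δ[1] ⟶ X) (h₀ : ι₀ ≫ L = ι₀ ≫ L')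
    (h : L ≫ q = L' ≫ q) :
    ∃ K : Z ⊗ Δ[1] ⟶ X, ι₀ ≫ K = ι₁ ≫ L ∧ ι₁ ≫ K = ι₁ ≫ L' ∧ K ≫ q = fst _ _ ≫ ι₁ ≫ L ≫ q := by
  classical
  -- the map from `(Z × ∂Δ[1]) × Δ[1]` given by `L` and `L'` on the two ends
  let A : (Z ⊗ Δ[1] : SSet.{w}).Subcomplex := Subcomplex.range ι₀ ⊔ Subcomplex.range ι₁
  let p : (A : SSet.{w}) ⊗ Δ[1] ⟶ Z ⊗ Δ[1] := A.ι ▷ _ ≫ fst _ _ ▷ _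
  let P {n} (x : ((A : SSet.{w}) ⊗ Δ[1]).obj n) : Prop := x.1.1 ∈ (Subcomplex.range ι₀).obj n
  have hP {n m} (f : n ⟶ m) (x : ((A : SSet.{w}) ⊗ Δ[1]).obj n) :
      P (((A : SSet.{w}) ⊗ Δ[1]).map f x) ↔ P x := by
    refine ⟨fun hx ↦ ?_, fun hx ↦ (Subcomplex.range ι₀).map f hx⟩
    rcases x.1.2 with hx' | hx'
    · exact hx'
    · obtain ⟨z, hz⟩ := hx
      obtain ⟨z', hz'⟩ := (Subcomplex.range ι₁).map f hx'
      exact (ι₀_app_ne_ι₁_app _ _ (hz.trans hz'.symm)).elim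
  let g {n} (x : ((A : SSet.{w}) ⊗ Δ[1]).obj n) : X.obj n :=
    if P x then (p ≫ L).app n x else (p ≫ L').app n x
  have hg₁ {n} (x : ((A : SSet.{w}) ⊗ Δ[1]).obj n) (hx : P x) : g x = (p ≫ L).app n x :=
    if_pos hx
  have hg₂ {n} (x : ((A : SSet.{w}) ⊗ Δ[1]).obj n) (hx : ¬ P x) : g x = (p ≫ L').app n x :=
    if_neg hx
  have hg {n m} (f : n ⟶ m) (x : ((A : SSet.{w}) ⊗ Δ[1]).obj n) :
      g (((A : SSet.{w}) ⊗ Δ[1]).map f x) = X.map f (g x) := by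
    by_cases hx : P x
    · rw [hg₁ x hx, hg₁ _ ((hP f x).2 hx)]
      exact ConcreteCategory.congr_hom ((p ≫ L).naturality f) x
    · rw [hg₂ x hx, hg₂ _ (mt (hP f x).1 hx)]
      exact ConcreteCategory.congr_hom ((p ≫ L').naturality f) x
  let a : (A : SSet.{w}) ⊗ Δ[1] ⟶ X :=
    { app n := ↾g
      naturality n m f := ConcreteCategory.hom_ext _ _ (hg f) }
  have ha₁ {n} (x : ((A : SSet.{w}) ⊗ Δ[1]).obj n) (hx : P x) : a.app n x = (p ≫ L).app n x :=
    hg₁ x hx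
  have ha₂ {n} (x : ((A : SSet.{w}) ⊗ Δ[1]).obj n) (hx : ¬ P x) : a.app n x = (p ≫ L').app n x :=
    hg₂ x hx
  clear_value a
  obtain ⟨M, hM, -, hMq⟩ := hq.exists_relative_lift A.ι a (fst _ _ ≫ ι₀ ≫ L)
    (fst _ _ ▷ _ ≫ L ≫ q) (by
      refine NatTrans.ext (funext fun n ↦ ConcreteCategory.hom_ext _ _ fun x ↦ ?_)
      by_cases hx : P (ι₀.app n x)
      · exact ha₁ _ hx
      · exact (ha₂ _ hx).trans (ConcreteCategory.congr_hom (congrArg (fun t ↦ t.app n) h₀.symm)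
          (((fst _ _ : Z ⊗ Δ[1] ⟶ Z).app n) x.1)))
    (by
      refine NatTrans.ext (funext fun n ↦ ConcreteCategory.hom_ext _ _ fun x ↦ ?_)
      by_cases hx : P x
      · exact congrArg (q.app n) (ha₁ x hx)
      · exact (congrArg (q.app n) (ha₂ x hx)).trans
          (ConcreteCategory.congr_hom (congrArg (fun t ↦ t.app n) h.symm) (p.app n x)))
    rfl
  refine ⟨ι₁ ≫ M, ?_, ?_, ?_⟩
  · let e : Z ⟶ (A : SSet.{w}) := Subcomplex.lift ι₀ le_sup_left
    have h1 : ι₀ ≫ ι₁ ≫ M = e ≫ ι₁ ≫ A.ι ▷ _ ≫ M := rfl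
    rw [h1, hM]
    refine NatTrans.ext (funext fun n ↦ ConcreteCategory.hom_ext _ _ fun x ↦ ?_)
    exact ha₁ _ ⟨x, rfl⟩
  · let e : Z ⟶ (A : SSet.{w}) := Subcomplex.lift ι₁ le_sup_right
    have h1 : ι₁ ≫ ι₁ ≫ M = e ≫ ι₁ ≫ A.ι ▷ _ ≫ M := rfl
    rw [h1, hM]
    refine NatTrans.ext (funext fun n ↦ ConcreteCategory.hom_ext _ _ fun x ↦ ?_)
    refine ha₂ _ ?_
    rintro ⟨z, hz⟩
    exact ι₀_app_ne_ι₁_app _ _ hz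
  · rw [Category.assoc, hMq]
    rfl

end LeftAnodyne

/-! ### Mapping spaces over a base -/

section MapOver

open SSet

variable {S T X : SSet.{w}} (f : S ⟶ T) (q : X ⟶ T)

lemma app_congr {A B : SSet.{w}} {a b : A ⟶ B} (h : a = b) {n : SimplexCategoryᵒᵖ}
    (x : A.obj n) : a.app n x = b.app n x := by rw [h]

lemma app_naturality {A B : SSet.{w}} (a : A ⟶ B) {n m : SimplexCategoryᵒᵖ} (t : n ⟶ m)
    (x : A.obj n) : a.app m (A.map t x) = B.map t (a.app n x) :=
  NatTrans.naturality_apply a t x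

/-- The tautological simplex of `Δ[n]`, paired with a simplex `s` of `S`. -/
def withId {n : SimplexCategoryᵒᵖ} (s : S.obj n) :
    (S ⊗ SSet.stdSimplex.obj n.unop : SSet.{w}).obj n :=
  ⟨s, stdSimplex.objEquiv.symm (𝟙 n.unop)⟩

/-- The evaluation map `S × Map_T(S, X) ⟶ X`. -/
def mapOverEval : S ⊗ mapOver f q ⟶ X where
  app n := ↾fun x ↦ x.2.1.app n (withId x.1)
  naturality _ _ a := ConcreteCategory.hom_ext _ _ fun x ↦ app_naturality x.2.1 a (withId x.1)

lemma mapOverEval_comp : mapOverEval f q ≫ q = fst _ _ ≫ f :=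
  NatTrans.ext (funext fun _ ↦ ConcreteCategory.hom_ext _ _ fun x ↦
    app_congr x.2.2 (withId x.1))

variable {f q}

/-- The map `P ⟶ Map_T(S, X)` corresponding to a map `S × P ⟶ X` over `T`. -/
def mapOverCurry {P : SSet.{w}} (g : S ⊗ P ⟶ X) (hg : g ≫ q = fst _ _ ≫ f) :
    P ⟶ mapOver f q where
  app n := ↾fun p ↦ ⟨S ◁ yonedaEquiv.symm p ≫ g, by
    rw [Category.assoc, hg, whiskerLeft_fst_assoc]⟩
  naturality n m a := ConcreteCategory.hom_ext _ _ fun p ↦ Subtype.ext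
    ((congrArg (fun t ↦ S ◁ t ≫ g) (yonedaEquiv_symm_naturality_left a.unop p)).symm.trans
      (by rw [MonoidalCategory.whiskerLeft_comp, Category.assoc]; rfl))

lemma whiskerLeft_mapOverCurry_eval {P : SSet.{w}} (g : S ⊗ P ⟶ X) (hg : g ≫ q = fst _ _ ≫ f) :
    S ◁ mapOverCurry g hg ≫ mapOverEval f q = g := by
  refine NatTrans.ext (funext fun n ↦ ConcreteCategory.hom_ext _ _ fun x ↦ ?_)
  have h : P.map (𝟙 n) x.2 = x.2 := by
    rw [CategoryTheory.Functor.map_id]; rfl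
  exact congrArg (fun t ↦ g.app n ((x.1, t) : S.obj n × P.obj n)) h

lemma mapOver_app_eq {P : SSet.{w}} (c : P ⟶ mapOver f q) {n : SimplexCategoryᵒᵖ} (p : P.obj n) :
    (c.app n p).1 = S ◁ yonedaEquiv.symm p ≫ S ◁ c ≫ mapOverEval f q := by
  refine NatTrans.ext (funext fun m ↦ ConcreteCategory.hom_ext _ _ fun x ↦ ?_)
  have h₁ := congrArg Subtype.val (app_naturality c (stdSimplex.objEquiv x.2).op p)
  have h₂ : stdSimplex.objEquiv.symm (𝟙 m.unop ≫ stdSimplex.objEquiv x.2) = x.2 := by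
    rw [Category.id_comp, Equiv.symm_apply_apply]
  exact (congrArg (fun t ↦ (c.app n p).1.app m ((x.1, t) : S.obj m × _)) h₂).symm.trans
    (app_congr h₁ (withId x.1)).symm

lemma mapOver_hom_ext {P : SSet.{w}} {a b : P ⟶ mapOver f q}
    (h : S ◁ a ≫ mapOverEval f q = S ◁ b ≫ mapOverEval f q) : a = b := by
  refine NatTrans.ext (funext fun n ↦ ConcreteCategory.hom_ext _ _ fun p ↦ Subtype.ext ?_)
  exact (mapOver_app_eq a p).trans
    ((congrArg (fun t ↦ S ◁ yonedaEquiv.symm p ≫ t) h).trans (mapOver_app_eq b p).symm)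

lemma whiskerLeft_mapOverRestrict_eval (f : S ⟶ T) (q : X ⟶ T) :
    S ◁ mapOverRestrict f q ≫ mapOverEval f q = f ▷ _ ≫ mapOverEval (𝟙 T) q :=
  NatTrans.ext (funext fun _ ↦ ConcreteCategory.hom_ext _ _ fun _ ↦ rfl)

/-- A homotopy over `T` between maps `S × P ⟶ X` is a homotopy between the corresponding maps
`P ⟶ Map_T(S, X)`. -/
lemma homotopic_of_homotopy {P : SSet.{w}} (a b : P ⟶ mapOver f q) (K : (S ⊗ P) ⊗ Δ[1] ⟶ X)
    (h₀ : ι₀ ≫ K = S ◁ a ≫ mapOverEval f q) (h₁ : ι₁ ≫ K = S ◁ b ≫ mapOverEval f q)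
    (hK : K ≫ q = fst _ _ ≫ fst _ _ ≫ f) : Homotopic a b := by
  let k : P ⊗ Δ[1] ⟶ mapOver f q := mapOverCurry ((α_ _ _ _).inv ≫ K) (by
    rw [Category.assoc, hK]
    rfl)
  have hk : S ◁ k ≫ mapOverEval f q = (α_ _ _ _).inv ≫ K := whiskerLeft_mapOverCurry_eval _ _
  refine Relation.EqvGen.rel _ _ ⟨{ h := k, h₀ := ?_, h₁ := ?_, rel := ?_ }⟩
  · refine mapOver_hom_ext ?_
    rw [MonoidalCategory.whiskerLeft_comp, Category.assoc, hk]
    exact h₀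
  · refine mapOver_hom_ext ?_
    rw [MonoidalCategory.whiskerLeft_comp, Category.assoc, hk]
    exact h₁
  · exact NatTrans.ext (funext fun n ↦ ConcreteCategory.hom_ext _ _ fun x ↦ x.1.2.elim)

/-- Suppose that `g : T ⟶ S` comes with a homotopy `H` from `g ≫ f` to the identity of `T` and a
homotopy `K` from `f ≫ g` to the identity of `S`, and that `f` takes `K` to the restriction of `H`
to `S`. Then `f` is coinitial: transport along `H` extends sections of a left fibration from `S`
to `T`. -/
theorem isCoinitialMap_of_homotopies (f : S ⟶ T) (g : T ⟶ S) (H : T ⊗ Δ[1] ⟶ T)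
    (K : S ⊗ Δ[1] ⟶ S) (H₀ : ι₀ ≫ H = g ≫ f) (H₁ : ι₁ ≫ H = 𝟙 T) (K₀ : ι₀ ≫ K = f ≫ g)
    (K₁ : ι₁ ≫ K = 𝟙 S) (hKH : K ≫ f = f ▷ _ ≫ H) : IsCoinitialMap f := by
  intro X q hq
  obtain ⟨L, hL₀, hL⟩ := hq.exists_lift (g ▷ _ ≫ mapOverEval f q) (fst _ _ ▷ _ ≫ H) (by
    rw [Category.assoc, mapOverEval_comp, whiskerRight_fst_assoc, ι₀_comp_assoc, H₀])
  let r : mapOver f q ⟶ mapOver (𝟙 T) q := mapOverCurry (ι₁ ≫ L) (by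
    rw [Category.assoc, hL, ι₁_comp_assoc, H₁])
  have hr : T ◁ r ≫ mapOverEval (𝟙 T) q = ι₁ ≫ L := whiskerLeft_mapOverCurry_eval _ _
  refine ⟨r, ?_, ?_⟩
  · let L' : (T ⊗ mapOver (𝟙 T) q) ⊗ Δ[1] ⟶ X :=
      lift (fst _ _ ▷ _ ≫ H) (fst _ _ ≫ snd _ _) ≫ mapOverEval (𝟙 T) q
    have hL' : (T ◁ mapOverRestrict f q) ▷ _ ≫ L ≫ q = fst _ _ ▷ _ ≫ H := by
      rw [hL]
      rfl
    obtain ⟨M, hM₀, hM₁, hM⟩ := hq.exists_homotopy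
      ((T ◁ mapOverRestrict f q) ▷ _ ≫ L) L' (by
        rw [ι₀_comp_assoc, hL₀, whisker_exchange_assoc, whiskerLeft_mapOverRestrict_eval,
          comp_lift_assoc, ι₀_comp_assoc, H₀]
        rfl)
      (by
        rw [Category.assoc, hL', Category.assoc, mapOverEval_comp, lift_fst_assoc,
          Category.comp_id])
    refine homotopic_of_homotopy _ _ M ?_ ?_ ?_
    · rw [hM₀, ι₁_comp_assoc, MonoidalCategory.whiskerLeft_comp, Category.assoc, hr]
    · rw [hM₁, comp_lift_assoc, ι₁_comp_assoc, H₁]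
      rfl
    · rw [hM, Category.assoc, hL', ι₁_comp_assoc, H₁]
  · let L' : (S ⊗ mapOver f q) ⊗ Δ[1] ⟶ X :=
      lift (fst _ _ ▷ _ ≫ K) (fst _ _ ≫ snd _ _) ≫ mapOverEval f q
    have hL' : (f ▷ mapOver f q) ▷ _ ≫ L ≫ q = fst _ _ ▷ _ ≫ K ≫ f := by
      rw [hL, hKH]
      rfl
    obtain ⟨M, hM₀, hM₁, hM⟩ := hq.exists_homotopy ((f ▷ mapOver f q) ▷ _ ≫ L) L' (by
        rw [ι₀_comp_assoc, hL₀, comp_lift_assoc, ι₀_comp_assoc, K₀]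
        rfl)
      (by
        rw [Category.assoc, hL', Category.assoc, mapOverEval_comp, lift_fst_assoc,
          Category.assoc])
    refine homotopic_of_homotopy _ _ M ?_ ?_ ?_
    · rw [hM₀, ι₁_comp_assoc, MonoidalCategory.whiskerLeft_comp, Category.assoc,
        whiskerLeft_mapOverRestrict_eval, whisker_exchange_assoc, hr]
    · rw [hM₁, comp_lift_assoc, ι₁_comp_assoc, K₁]
      rfl
    · rw [hM, Category.assoc, hL', ι₁_comp_assoc, reassoc_of% K₁]

end MapOver

/-! ### Coinitial functors of ordinary categories -/

section Nerve

open SSet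

variable {C D E : Type u} [Category.{v} C] [Category.{v} D] [Category.{v} E]

/-- The map `N(C) × Δ[1] ⟶ N(D)` given by a functor from `[1]` to the category of functors from
`C` to `D`. -/
def nerveHomotopy (Φ : Fin 2 ⥤ (C ⥤ D)) : nerve C ⊗ Δ[1] ⟶ nerve D where
  app _ := ↾fun x ↦ Functor.prod'
    ((stdSimplex.objEquiv x.2).toOrderHom.monotone.functor ⋙ Φ) x.1 ⋙ Functor.uncurry.obj (𝟭 _)
  naturality _ _ _ := ConcreteCategory.hom_ext _ _ fun _ ↦ rfl

lemma ι₀_nerveHomotopy (Φ : Fin 2 ⥤ (C ⥤ D)) : ι₀ ≫ nerveHomotopy Φ = nerveMap (Φ.obj 0) := by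
  refine NatTrans.ext (funext fun n ↦ ConcreteCategory.hom_ext _ _ fun x ↦ ?_)
  refine CategoryTheory.Functor.hext (fun i ↦ rfl) (fun i j h ↦ heq_of_eq ?_)
  have h₁ : (Φ.map (𝟙 0)).app (x.obj i) = 𝟙 _ := by rw [Φ.map_id]; rfl
  change (Φ.map (𝟙 0)).app (x.obj i) ≫ (Φ.obj 0).map (x.map h) = _
  rw [h₁, Category.id_comp]
  rfl

lemma ι₁_nerveHomotopy (Φ : Fin 2 ⥤ (C ⥤ D)) : ι₁ ≫ nerveHomotopy Φ = nerveMap (Φ.obj 1) := by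
  refine NatTrans.ext (funext fun n ↦ ConcreteCategory.hom_ext _ _ fun x ↦ ?_)
  refine CategoryTheory.Functor.hext (fun i ↦ rfl) (fun i j h ↦ heq_of_eq ?_)
  have h₁ : (Φ.map (𝟙 1)).app (x.obj i) = 𝟙 _ := by rw [Φ.map_id]; rfl
  change (Φ.map (𝟙 1)).app (x.obj i) ≫ (Φ.obj 1).map (x.map h) = _
  rw [h₁, Category.id_comp]
  rfl

lemma nerveHomotopy_comp_nerveMap (Φ : Fin 2 ⥤ (C ⥤ D)) (F : D ⥤ E) :
    nerveHomotopy Φ ≫ nerveMap F =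
      nerveHomotopy (Φ ⋙ (Functor.whiskeringRight C D E).obj F) := by
  refine NatTrans.ext (funext fun n ↦ ConcreteCategory.hom_ext _ _ fun x ↦ ?_)
  refine CategoryTheory.Functor.hext (fun i ↦ rfl) (fun i j h ↦ heq_of_eq ?_)
  exact F.map_comp _ _

lemma nerveMap_whiskerRight_comp_nerveHomotopy (F : C ⥤ D) (Φ : Fin 2 ⥤ (D ⥤ E)) :
    nerveMap F ▷ _ ≫ nerveHomotopy Φ =
      nerveHomotopy (Φ ⋙ (Functor.whiskeringLeft C D E).obj F) :=
  rfl

/-- A functor `F : C ⥤ D` is coinitial as soon as there are a functor `G : D ⥤ C` and natural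
transformations `α : G ⋙ F ⟶ 𝟭 D` and `β : F ⋙ G ⟶ 𝟭 C` with `F β = α F`. -/
theorem isCoinitial_of_natTrans (F : C ⥤ D) (G : D ⥤ C) (α : G ⋙ F ⟶ 𝟭 D) (β : F ⋙ G ⟶ 𝟭 C)
    (h : ∀ c, F.map (β.app c) = α.app (F.obj c)) : IsCoinitial F := by
  refine isCoinitialMap_of_homotopies (nerveMap F) (nerveMap G)
    (nerveHomotopy (ComposableArrows.mk₁ α)) (nerveHomotopy (ComposableArrows.mk₁ β))
    (ι₀_nerveHomotopy _) (ι₁_nerveHomotopy _) (ι₀_nerveHomotopy _) (ι₁_nerveHomotopy _) ?_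
  rw [nerveHomotopy_comp_nerveMap, nerveMap_whiskerRight_comp_nerveHomotopy]
  refine congrArg nerveHomotopy (ComposableArrows.ext₁ rfl rfl ?_)
  refine Eq.trans (b := Functor.whiskerLeft F α) (NatTrans.ext (funext h)) ?_
  exact (Category.comp_id _).symm.trans (Category.id_comp _).symm

/-- A criterion for coinitiality. Suppose that `F` is fully faithful on morphisms out of the
objects of a class `P`, and that every object `d` of `D` has a coreflection `F c₀ ⟶ d` in the image
of `P`. Then `F` is coinitial, since objects of `P` also coreflect the objects of `C`, and `F`
preserves these coreflections. -/
theorem isCoinitial_of_coreflections (F : C ⥤ D) (P : C → Prop)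
    (hF : ∀ c₀ c, P c₀ → Function.Bijective (F.map : (c₀ ⟶ c) → (F.obj c₀ ⟶ F.obj c)))
    (hP : ∀ d, ∃ (c₀ : C) (α : F.obj c₀ ⟶ d), P c₀ ∧
      ∀ c₁, P c₁ → Function.Bijective fun h : c₁ ⟶ c₀ ↦ F.map h ≫ α) : IsCoinitial F := by
  choose G α hG hα using hP
  have hex (d d' : D) (k : d ⟶ d') : ∃ g : G d ⟶ G d', F.map g ≫ α d' = α d ≫ k :=
    (hα d' (G d) (hG d)).2 _
  choose g hg using hex
  let G' : D ⥤ C :=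
    { obj := G
      map {d d'} k := g d d' k
      map_id d := (hα d _ (hG d)).1 (by simp [hg])
      map_comp {d d' d''} k k' := (hα d'' _ (hG d)).1 (by
        simp only [Functor.map_comp, Category.assoc, hg]
        rw [reassoc_of% hg]) }
  have hβ (c : C) : ∃ b : G (F.obj c) ⟶ c, F.map b = α (F.obj c) := (hF _ c (hG _)).2 _
  choose b hb using hβ
  refine isCoinitial_of_natTrans F G' { app := α, naturality := fun d d' k ↦ hg d d' k }
    { app := b, naturality := fun c c' k ↦ ?_ } hb
  refine (hF _ c' (hG _)).1 ?_
  dsimp [G']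
  simp only [Functor.map_comp, hb, hg]

end Nerve

/-! ### The coCartesian fibration -/

lemma toTransport_comp_fiber {B : Type*} [Category* B] {F : B ⥤ Cat.{v, u}}
    (a b : Grothendieck F) {S : B} (f : a.base ⟶ S) (χ : a.transport f ⟶ b) :
    ∃ e, (a.toTransport f ≫ χ).fiber = eqToHom e ≫ χ.fiber := by
  refine ⟨by rw [Grothendieck.comp_base, F.map_comp]; rfl, ?_⟩
  rw [Grothendieck.comp_fiber]
  refine congrArg (eqToHom _ ≫ ·) ?_
  exact (congrArg (· ≫ χ.fiber) (CategoryTheory.Functor.map_id _ _)).trans (Category.id_comp _)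

lemma base_eq_of_isHomLift {B : Type*} [Category* B] {F : B ⥤ Cat.{v, u}} {a b : Grothendieck F}
    (f : (Grothendieck.forget F).obj a ⟶ (Grothendieck.forget F).obj b) (φ : a ⟶ b)
    (h : (Grothendieck.forget F).IsHomLift f φ) : f = φ.base := by
  have := h
  exact IsHomLift.eq_of_isHomLift (Grothendieck.forget F) f φ

lemma eqToHom_comp_eqToHom_comp {C : Type u} [Category.{v} C] {x y z t : C} (p : x = y)
    (q : y = z) (r : x = z) (f : z ⟶ t) : eqToHom p ≫ eqToHom q ≫ f = eqToHom r ≫ f := by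
  rw [eqToHom_trans_assoc]

lemma isStronglyCocartesian_toTransport {B : Type*} [Category* B] (F : B ⥤ Cat.{v, u})
    (a : Grothendieck F) {S : B} (f : a.base ⟶ S) :
    (Grothendieck.forget F).IsStronglyCocartesian f (a.toTransport f) where
  toIsHomLift := .map (p := Grothendieck.forget F) (a.toTransport f)
  universal_property' {b} g φ hφ := by
    have hb : f ≫ g = φ.base := base_eq_of_isHomLift _ _ hφ
    have e : (F.map g).toFunctor.obj ((F.map f).toFunctor.obj a.fiber) =
        (F.map φ.base).toFunctor.obj a.fiber := by
      rw [← hb]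
      exact congrArg (fun t ↦ t.toFunctor.obj a.fiber) (F.map_comp f g).symm
    let χ : a.transport f ⟶ b := ⟨g, eqToHom e ≫ φ.fiber⟩
    refine ⟨χ, ⟨.map (p := Grothendieck.forget F) χ, ?_⟩, ?_⟩
    · refine Grothendieck.ext _ _ hb ?_
      obtain ⟨e', h⟩ := toTransport_comp_fiber a b f χ
      rw [h, eqToHom_trans_assoc]
      exact (eqToHom_comp_eqToHom_comp _ _ rfl _).trans (Category.id_comp _)
    · rintro χ' ⟨hχ, rfl⟩
      have hg : g = χ'.base := base_eq_of_isHomLift (a := a.transport f) _ _ hχ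
      refine Grothendieck.ext _ _ hg.symm ?_
      obtain ⟨e', h⟩ := toTransport_comp_fiber a b f χ'
      refine Eq.trans ?_ (congrArg (eqToHom e ≫ ·) h).symm
      exact (eqToHom_comp_eqToHom_comp _ _ _ _).symm

/-- The Grothendieck construction of a functor to categories is a coCartesian fibration. -/
theorem isCocartesianFibration_forget {B : Type*} [Category* B] (F : B ⥤ Cat.{v, u}) :
    IsCocartesianFibration (Grothendieck.forget F) :=
  fun a _ f ↦ ⟨_, _, isStronglyCocartesian_toTransport F a f⟩

/-! ### Chains of finite sets in terms of elements -/

namespace FinChain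

variable {n m : SimplexCategory} {A B C : FinChain n}

/-- The elements of the `i`-th set of a chain. -/
abbrev El (A : FinChain n) (i : Fin (n.len + 1)) : Type := ULift.{0} (Fin (A.functor.obj i).len)

/-- The maps of a chain. -/
def act (A : FinChain n) {i j : Fin (n.len + 1)} (h : i ≤ j) : A.El i → A.El j :=
  A.functor.map (homOfLE h)

/-- The components of a morphism of chains. -/
def Hom.ap (f : A ⟶ B) (i : Fin (n.len + 1)) : A.El i → B.El i :=
  (FinChain.Hom.nat f).app i

lemma act_refl (A : FinChain n) {i : Fin (n.len + 1)} (h : i ≤ i) (x : A.El i) : A.act h x = x :=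
  congrFun (A.functor.map_id i) x

lemma act_act (A : FinChain n) {i j k : Fin (n.len + 1)} (h : i ≤ j) (h' : j ≤ k) (x : A.El i) :
    A.act h' (A.act h x) = A.act (h.trans h') x :=
  (congrFun (A.functor.map_comp (homOfLE h) (homOfLE h')) x).symm

/-- The maps of a chain between equal indices serve as casts. -/
lemma act_bijective_of_eq (A : FinChain n) {i j : Fin (n.len + 1)} (h : i ≤ j) (h' : i = j) :
    Function.Bijective (A.act h) := by
  subst h'
  exact ⟨fun x y hxy ↦ by rwa [act_refl, act_refl] at hxy, fun x ↦ ⟨x, A.act_refl h x⟩⟩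

lemma Hom.ap_act (f : A ⟶ B) {i j : Fin (n.len + 1)} (h : i ≤ j) (x : A.El i) :
    Hom.ap f j (A.act h x) = B.act h (Hom.ap f i x) :=
  congrFun (f.nat.naturality (homOfLE h)) x

lemma Hom.ap_injective (f : A ⟶ B) (i : Fin (n.len + 1)) : Function.Injective (Hom.ap f i) :=
  f.injective i

/-- The naturality squares of a morphism of chains are Cartesian. -/
lemma Hom.exists_ap_eq (f : A ⟶ B) {i j : Fin (n.len + 1)} (h : i ≤ j) (x : B.El i) (y : A.El j)
    (hxy : Hom.ap f j y = B.act h x) : ∃ a : A.El i, Hom.ap f i a = x := by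
  let P : FintypeCat.Skeleton.{0} := FintypeCat.Skeleton.mk 1
  have hp := f.isPullback i j h
  refine ⟨hp.lift (W := P) (fun _ ↦ y) (fun _ ↦ x) (funext fun _ ↦ hxy)
    (⟨0⟩ : ULift (Fin 1)), ?_⟩
  exact congrFun (hp.lift_snd (W := P) (fun _ ↦ y) (fun _ ↦ x) (funext fun _ ↦ hxy))
    (⟨0⟩ : ULift (Fin 1))

lemma Hom.ext_ap {f g : A ⟶ B} (h : ∀ i x, Hom.ap f i x = Hom.ap g i x) : f = g :=
  Hom.ext (NatTrans.ext (funext fun i ↦ funext (h i)))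

/-- Constructor for morphisms of chains in terms of elements. -/
def homMk (t : ∀ i, A.El i → B.El i) (ht : ∀ i, Function.Injective (t i))
    (nat : ∀ {i j : Fin (n.len + 1)} (h : i ≤ j) (x : A.El i),
      t j (A.act h x) = B.act h (t i x))
    (cart : ∀ {i j : Fin (n.len + 1)} (h : i ≤ j) (x : B.El i) (y : A.El j),
      t j y = B.act h x → ∃ a : A.El i, t i a = x) : A ⟶ B where
  nat := { app := t, naturality := fun i j h ↦ funext (nat (leOfHom h)) }
  injective := ht
  isPullback i j h := by
    have key (s : Limits.PullbackCone (C := FintypeCat.Skeleton.{0}) (X := A.functor.obj j)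
        (Y := B.functor.obj i) (t j) (B.functor.map (homOfLE h))) :
        ∃ l : s.pt ⟶ A.functor.obj i, l ≫ (t i : A.functor.obj i ⟶ B.functor.obj i) = s.snd :=
      ⟨fun w ↦ (cart h (s.snd w) (s.fst w) (congrFun s.condition w)).choose,
        funext fun w ↦ (cart h (s.snd w) (s.fst w) (congrFun s.condition w)).choose_spec⟩
    choose l hl using key
    refine ⟨⟨funext (nat h)⟩, ⟨Limits.PullbackCone.IsLimit.mk _ l (fun s ↦ ?_) hl ?_⟩⟩
    · refine funext fun w ↦ ht j ?_
      exact (nat h _).trans ((congrArg (B.act h) (congrFun (hl s) w)).trans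
        (congrFun s.condition w).symm)
    · intro s r _ hr
      exact funext fun w ↦ ht i ((congrFun hr w).trans (congrFun (hl s) w).symm)

@[simp]
lemma homMk_ap (t : ∀ i, A.El i → B.El i) (ht nat cart) (i : Fin (n.len + 1)) (x : A.El i) :
    Hom.ap (homMk t ht nat cart) i x = t i x :=
  rfl

lemma homMkSucc_nat (t : ∀ i, A.El i → B.El i)
    (nat : ∀ (i : Fin n.len) (x : A.El i.castSucc),
      t i.succ (A.act i.castSucc_le_succ x) = B.act i.castSucc_le_succ (t i.castSucc x))
    {i j : Fin (n.len + 1)} (h : i ≤ j) (x : A.El i) : t j (A.act h x) = B.act h (t i x) := by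
  induction j using Fin.induction with
  | zero =>
    obtain rfl : i = 0 := Fin.le_zero_iff.mp h
    rw [act_refl, act_refl]
  | succ j ih =>
    rcases h.eq_or_lt with rfl | h'
    · rw [act_refl, act_refl]
    · have h'' : i ≤ j.castSucc := Fin.le_castSucc_iff.mpr h'
      rw [← A.act_act h'' j.castSucc_le_succ, ← B.act_act h'' j.castSucc_le_succ, nat, ih h'']

lemma homMkSucc_cart (t : ∀ i, A.El i → B.El i)
    (cart : ∀ (i : Fin n.len) (x : B.El i.castSucc) (y : A.El i.succ),
      t i.succ y = B.act i.castSucc_le_succ x → ∃ a, t i.castSucc a = x)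
    {i j : Fin (n.len + 1)} (h : i ≤ j) (x : B.El i) (y : A.El j) (hxy : t j y = B.act h x) :
    ∃ a : A.El i, t i a = x := by
  induction j using Fin.induction with
  | zero =>
    obtain rfl : i = 0 := Fin.le_zero_iff.mp h
    exact ⟨y, hxy.trans (B.act_refl _ _)⟩
  | succ j ih =>
    rcases h.eq_or_lt with rfl | h'
    · exact ⟨y, hxy.trans (B.act_refl _ _)⟩
    · have h'' : i ≤ j.castSucc := Fin.le_castSucc_iff.mpr h'
      obtain ⟨a, ha⟩ := cart j (B.act h'' x) y (hxy.trans (B.act_act _ _ _).symm)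
      exact ih h'' a ha

/-- It suffices to check naturality and the Cartesian condition on consecutive sets. -/
def homMkSucc (t : ∀ i, A.El i → B.El i) (ht : ∀ i, Function.Injective (t i))
    (nat : ∀ (i : Fin n.len) (x : A.El i.castSucc),
      t i.succ (A.act i.castSucc_le_succ x) = B.act i.castSucc_le_succ (t i.castSucc x))
    (cart : ∀ (i : Fin n.len) (x : B.El i.castSucc) (y : A.El i.succ),
      t i.succ y = B.act i.castSucc_le_succ x → ∃ a, t i.castSucc a = x) : A ⟶ B :=
  homMk t ht (homMkSucc_nat t nat) (homMkSucc_cart t cart)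

/-- The comparison of the restrictions of a chain along two equal maps is given, on elements, by the
maps of the chain between equal indices. -/
lemma eqToHom_ap {φ ψ : n ⟶ m} {A' : FinChain m} (h : φ = ψ) (h' : (pull φ).obj A' = (pull ψ).obj A')
    (i : Fin (n.len + 1)) (x : ((pull φ).obj A').El i) :
    Hom.ap (eqToHom h') i x = A'.act (by rw [h]) x := by
  subst h
  exact (A'.act_refl _ x).symm

/-- A morphism of chains is surjective as soon as its last component is. -/
lemma surjective_of_last (f : A ⟶ B) (hf : Function.Surjective (Hom.ap f (Fin.last _)))
    (i : Fin (n.len + 1)) : Function.Surjective (Hom.ap f i) := fun x ↦ by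
  obtain ⟨y, hy⟩ := hf (B.act i.le_last x)
  exact Hom.exists_ap_eq f _ x y hy

/-- A morphism of chains `β` factors through a morphism `α` with the same target as soon as this
holds for the images of the last components. -/
lemma exists_factorization {R : FinChain n} (α : B ⟶ R) (β : A ⟶ R)
    (h : ∀ x, ∃ y, Hom.ap α (Fin.last _) y = Hom.ap β (Fin.last _) x) :
    ∃ γ : A ⟶ B, γ ≫ α = β := by
  have key (i : Fin (n.len + 1)) (x : A.El i) : ∃ y, Hom.ap α i y = Hom.ap β i x := by
    obtain ⟨y, hy⟩ := h (A.act i.le_last x)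
    rw [Hom.ap_act] at hy
    exact Hom.exists_ap_eq α _ _ y hy
  choose t ht using key
  refine ⟨homMk t ?_ ?_ ?_, Hom.ext_ap fun i x ↦ ht i x⟩
  · intro i x y hxy
    apply Hom.ap_injective β i
    rw [← ht, ← ht, hxy]
  · intro i j h x
    apply Hom.ap_injective α j
    rw [ht, Hom.ap_act, Hom.ap_act, ht]
  · intro i j h x y hxy
    obtain ⟨a, ha⟩ := Hom.exists_ap_eq β h (Hom.ap α i x) y (by rw [← ht, hxy, Hom.ap_act])
    exact ⟨a, Hom.ap_injective α i (by rw [ht, ha])⟩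

instance mono (f : A ⟶ B) : Mono f :=
  ⟨fun _ _ e ↦ Hom.ext_ap fun i x ↦ Hom.ap_injective f i
    (congrArg (fun t ↦ Hom.ap t i x) e)⟩

/-- Morphisms of chains with surjective components are isomorphisms. -/
lemma isIso_of_surjective (f : A ⟶ B) (hf : ∀ i, Function.Surjective (Hom.ap f i)) : IsIso f := by
  obtain ⟨g, hg⟩ := exists_factorization f (𝟙 B) fun x ↦ hf _ x
  exact ⟨g, by rw [← cancel_mono f, Category.assoc, hg, Category.comp_id, Category.id_comp], hg⟩

/-- Every functor from `[n]` to finite sets is isomorphic to a chain. -/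
lemma exists_chain (n : SimplexCategory) (T : Fin (n.len + 1) → Type) [∀ i, Finite (T i)]
    (t : ∀ {i j : Fin (n.len + 1)}, i ≤ j → T i → T j)
    (t_refl : ∀ {i} (x : T i), t le_rfl x = x)
    (t_trans : ∀ {i j k} (h : i ≤ j) (h' : j ≤ k) (x : T i), t h' (t h x) = t (h.trans h') x) :
    ∃ (A : FinChain n) (e : ∀ i, A.El i ≃ T i),
      ∀ {i j} (h : i ≤ j) (x : A.El i), e j (A.act h x) = t h (e i x) := by
  let e (i) : ULift.{0} (Fin (Nat.card (T i))) ≃ T i :=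
    Equiv.ulift.trans (Finite.equivFin (T i)).symm
  refine ⟨⟨{ obj i := FintypeCat.Skeleton.mk (Nat.card (T i))
             map {i j} h := fun x ↦ (e j).symm (t (leOfHom h) (e i x))
             map_id i := funext fun x ↦ ?_
             map_comp h h' := funext fun x ↦ ?_ }⟩, e, fun {i j} h x ↦ ?_⟩
  · exact (congrArg (e i).symm (t_refl _)).trans ((e i).symm_apply_apply x)
  · refine congrArg (e _).symm ((t_trans (leOfHom h) (leOfHom h') _).symm.trans ?_)
    exact congrArg (t (leOfHom h')) ((e _).apply_symm_apply _).symm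
  · exact (e j).apply_symm_apply _

/-- A chain can be restricted to a subset of its last set. -/
lemma exists_restriction (B : FinChain n) (s : Set (B.El (Fin.last _))) :
    ∃ (A : FinChain n) (f : A ⟶ B), Set.range (Hom.ap f (Fin.last _)) = s := by
  obtain ⟨A, e, he⟩ := exists_chain n (fun i ↦ {x : B.El i // B.act i.le_last x ∈ s})
    (fun h x ↦ ⟨B.act h x.1, by rw [act_act]; exact x.2⟩)
    (fun x ↦ Subtype.ext (B.act_refl _ _)) (fun h h' x ↦ Subtype.ext (B.act_act _ _ _))
  refine ⟨A, homMk (fun i x ↦ (e i x).1) ?_ ?_ ?_, ?_⟩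
  · exact fun i ↦ Subtype.val_injective.comp (e i).injective
  · intro i j h x
    rw [he]
  · intro i j h x y hxy
    refine ⟨(e i).symm ⟨x, ?_⟩, by rw [Equiv.apply_symm_apply]⟩
    rw [← act_act B h j.le_last, ← hxy]
    exact (e j y).2
  · ext x
    refine ⟨?_, fun hx ↦ ⟨(e _).symm ⟨x, by rwa [act_refl]⟩, ?_⟩⟩
    swap
    · rw [homMk_ap, Equiv.apply_symm_apply]
    rintro ⟨y, rfl⟩
    have := (e _ y).2
    rwa [act_refl] at this

end FinChain

/-! ### The Segal condition -/

lemma SegalChain.isIso_of_isIso_map {X : SimplexCategoryᵒᵖ ⥤ Cat.{v, u}} {k : ℕ}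
    {S T : SegalChain X k} (f : S ⟶ T) (hf : ∀ i, IsIso (SegalChain.Hom.map f i)) : IsIso f := by
  let g : T ⟶ S :=
    SegalChain.Hom.mk (fun i ↦ inv (SegalChain.Hom.map f i)) fun j ↦ by
      have := SegalChain.Hom.comm f j
      rw [Functor.map_inv, Functor.map_inv, IsIso.inv_comp_eq, ← Category.assoc,
        IsIso.eq_comp_inv, this]
  exact ⟨g, SegalChain.Hom.ext (funext fun i ↦ IsIso.hom_inv_id _),
    SegalChain.Hom.ext (funext fun i ↦ IsIso.inv_hom_id _)⟩

namespace DeltaF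

open FinChain

variable {k : ℕ}

/-- The functor taking a chain to its `i`-th set. -/
def evaluation {n : SimplexCategory} (i : Fin (n.len + 1)) :
    FinChain n ⥤ FintypeCat.Skeleton.{0} where
  obj A := A.functor.obj i
  map f := (FinChain.Hom.nat f).app i

/-- On elements, the comparison isomorphism of a commutative square of the simplex category is a
map of the chain between equal indices. -/
lemma reindexSquare_ap {a b b' c : SimplexCategory} {f : a ⟶ b} {g : b ⟶ c} {f' : a ⟶ b'}
    {g' : b' ⟶ c} (h : f ≫ g = f' ≫ g') (A : FinChain c) (i : Fin (a.len + 1))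
    (x : A.El (g.toOrderHom (f.toOrderHom i))) :
    Hom.ap (n := a) ((reindexSquare fibre h).hom.app A) i x =
      A.act (congrArg (fun t : a ⟶ c ↦ t.toOrderHom i) h).le x := by
  have e : (reindexSquare fibre h).hom.app A = eqToHom (by
      change (pull (f ≫ g)).obj A = (pull (f' ≫ g')).obj A
      rw [h]) := by
    exact eqToHom_app (by
      change (fibre.map (f ≫ g).op).toFunctor = (fibre.map (f' ≫ g').op).toFunctor
      rw [h]) A
  exact (congrFun (congrArg (fun t ↦ Hom.ap (n := a) (A := (pull (f ≫ g)).obj A)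
    (B := (pull (f' ≫ g')).obj A) t i) e) x).trans (eqToHom_ap h _ i x)

/-- Compatibility with the gluing isomorphisms, on elements. -/
lemma segal_comm {S T : SegalChain fibre k} (f : S ⟶ T) (j : Fin k)
    (x : FinChain.El (n := ⦋1⦌) (S.edge j.castSucc) 1) :
    Hom.ap (n := ⦋0⦌) (T.glue j).hom 0 (Hom.ap (n := ⦋1⦌) (SegalChain.Hom.map f j.castSucc) 1 x) =
      Hom.ap (n := ⦋1⦌) (SegalChain.Hom.map f j.succ) 0 (Hom.ap (n := ⦋0⦌) (S.glue j).hom 0 x) :=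
  congrFun (congrArg (fun t ↦ Hom.ap (n := ⦋0⦌) (A := (pull (SimplexCategory.δ (0 : Fin 2))).obj
    (S.edge j.castSucc)) (B := (pull (SimplexCategory.δ (1 : Fin 2))).obj (T.edge j.succ)) t 0)
    (SegalChain.Hom.comm f j)) x

/-- The gluing isomorphisms of a Segal chain that comes from a chain are the identity on
elements. -/
lemma segal_glue_ap (A : FinChain ⦋k + 1⦌) (j : Fin k) (x : A.El j.succ.castSucc) :
    Hom.ap (n := ⦋0⦌) (((segalFunctor fibre k).obj A).glue j).hom 0 x = x :=
  (reindexSquare_ap (vertex_eq j) A 0 x).trans (A.act_refl _ x)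

instance (k : ℕ) : (segalFunctor fibre k).Faithful where
  map_injective {A B} f g h := by
    refine Hom.ext_ap (n := ⦋k + 1⦌) fun i x ↦ ?_
    induction i using Fin.cases with
    | zero => exact congrArg (fun t ↦ Hom.ap (n := ⦋1⦌) (SegalChain.Hom.map t 0) 0 x) h
    | succ i => exact congrArg (fun t ↦ Hom.ap (n := ⦋1⦌) (SegalChain.Hom.map t i) 1 x) h

/-- A compatible family of morphisms of edges defines a morphism at the vertex `0` by the source of
the edge `0`, and at the vertex `i + 1` by the target of the edge `i`. -/
instance (k : ℕ) : (segalFunctor fibre k).Full where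
  map_surjective {A B} e := by
    let A' : FinChain ⦋k + 1⦌ := A
    let B' : FinChain ⦋k + 1⦌ := B
    let t (i : Fin (k + 2)) : A'.El i → B'.El i :=
      Fin.cases (motive := fun i ↦ A'.El i → B'.El i)
        (Hom.ap (n := ⦋1⦌) (SegalChain.Hom.map e 0) 0)
        (fun i ↦ Hom.ap (n := ⦋1⦌) (SegalChain.Hom.map e i) 1) i
    have ht (i : Fin (k + 1)) (x : A'.El i.castSucc) :
        t i.castSucc x = Hom.ap (n := ⦋1⦌) (SegalChain.Hom.map e i) 0 x := by
      induction i using Fin.cases with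
      | zero => rfl
      | succ j =>
        refine (segal_glue_ap B' j _).symm.trans ((segal_comm e j x).trans ?_)
        exact congrArg _ (segal_glue_ap A' j x)
    refine ⟨homMkSucc (n := ⦋k + 1⦌) t ?_ ?_ ?_, ?_⟩
    · intro i
      induction i using Fin.cases with
      | zero => exact Hom.ap_injective (n := ⦋1⦌) (SegalChain.Hom.map e 0) 0
      | succ i => exact Hom.ap_injective (n := ⦋1⦌) (SegalChain.Hom.map e i) 1
    · intro i x
      refine Eq.trans ?_ (congrArg _ (ht i x).symm)
      exact Hom.ap_act (n := ⦋1⦌) (SegalChain.Hom.map e i) (i := 0) (j := 1) (by simp) x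
    · intro i x y h
      obtain ⟨a, ha⟩ := Hom.exists_ap_eq (n := ⦋1⦌) (SegalChain.Hom.map e i) (i := 0) (j := 1)
        (by simp) x y h
      exact ⟨a, (ht i a).trans ha⟩
    · refine SegalChain.Hom.ext (funext fun i ↦ Hom.ext_ap (n := ⦋1⦌) fun l x ↦ ?_)
      match l with
      | 0 => exact ht i x
      | 1 => rfl

/-- A family of edges with gluing isomorphisms defines a chain whose set at `0` is the source of the
edge `0`, and whose set at `i + 1` is the target of the edge `i`. -/
instance (k : ℕ) : (segalFunctor fibre k).EssSurj where
  mem_essImage S := by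
    let E (i : Fin (k + 1)) : FinChain ⦋1⦌ := S.edge i
    let T (i : Fin (k + 2)) : FintypeCat.Skeleton.{0} :=
      Fin.cases ((E 0).functor.obj 0) (fun i ↦ (E i).functor.obj 1) i
    -- the identification of the set at the vertex `i` with the source of the `i`-th edge
    let s (i : Fin (k + 1)) : T i.castSucc ≅ (E i).functor.obj 0 :=
      Fin.cases (motive := fun i ↦ T i.castSucc ≅ (E i).functor.obj 0) (Iso.refl _)
        (fun j ↦ (evaluation (n := ⦋0⦌) 0).mapIso (S.glue j)) i
    let σ (i : Fin (k + 1)) : T i.castSucc ⟶ T i.succ :=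
      (s i).hom ≫ (E i).functor.map (homOfLE (Fin.zero_le (1 : Fin 2)))
    let A : FinChain ⦋k + 1⦌ := ⟨ComposableArrows.mkOfObjOfMapSucc T σ⟩
    have hA (i : Fin (k + 1)) : A.functor.map (homOfLE i.castSucc_le_succ) = σ i :=
      ComposableArrows.mkOfObjOfMapSucc_map_succ T σ i.1 i.2
    let f (i : Fin (k + 1)) : (pull (SimplexCategory.mkOfSucc i)).obj A ⟶ E i :=
      homMkSucc (n := ⦋1⦌)
        (fun l ↦ match l with
          | 0 => (s i).hom
          | 1 => fun x ↦ x)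
        (fun l ↦ match l with
          | 0 => Function.LeftInverse.injective (g := (s i).inv) (congrFun (s i).hom_inv_id)
          | 1 => fun _ _ h ↦ h)
        (fun l x ↦ match l with
          | 0 => congrFun (hA i) x)
        (fun l x y _ ↦ match l with
          | 0 => ⟨(s i).inv x, congrFun (s i).inv_hom_id x⟩)
    have hf (i : Fin (k + 1)) : IsIso (f i) := isIso_of_surjective _ fun l ↦ match l with
      | 0 => fun x ↦ ⟨(s i).inv x, congrFun (s i).inv_hom_id x⟩
      | 1 => fun x ↦ ⟨x, rfl⟩
    let F : (segalFunctor fibre k).obj A ⟶ S :=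
      SegalChain.Hom.mk f fun j ↦ Hom.ext_ap (n := ⦋0⦌) fun l x ↦ by
        obtain rfl : l = 0 := Subsingleton.elim (α := Fin 1) _ _
        exact (congrArg (Hom.ap (f j.succ) 0) (segal_glue_ap A j x)).symm
    have hF : IsIso F := SegalChain.isIso_of_isIso_map F hf
    exact ⟨A, ⟨asIso F⟩⟩

/-- The fibres of `Δ_𝔽` satisfy the Segal condition: chains and their morphisms are glued from
edges. -/
theorem isCategoryObject_fibre : IsCategoryObject fibre := fun _ ↦
  { }

end DeltaF

/-! ### The pieces cut out by an active map -/

section Pieces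

variable {m n : ℕ} (φ : ⦋m⦌ ⟶ ⦋n⦌)

/-- The `t`-th element of the interval `{φ(j), …, φ(j + 1)}` is `φ(j) + t`. -/
lemma piece_val (j : Fin m) (t : Fin (gap φ j + 1)) :
    ((piece φ j).toOrderHom t : ℕ) = φ.toOrderHom j.castSucc + t :=
  Nat.add_comm _ _

/-- The end points of the `j`-th piece are `φ(j)` and `φ(j + 1)`. -/
lemma piece_diag (j : Fin m) (l : Fin 2) :
    (piece φ j).toOrderHom ((SimplexCategory.diag (gap φ j)).toOrderHom l) =
      φ.toOrderHom ((SimplexCategory.mkOfSucc j).toOrderHom l) :=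
  (congrArg (fun t : ⦋1⦌ ⟶ ⦋n⦌ ↦ t.toOrderHom l) (piece_eq φ j)).symm

lemma castSucc_le_piece (j : Fin m) (t : Fin (gap φ j + 1)) :
    φ.toOrderHom j.castSucc ≤ (piece φ j).toOrderHom t := by
  rw [Fin.le_def, piece_val]
  exact Nat.le_add_right _ _

lemma piece_le_succ (j : Fin m) (t : Fin (gap φ j + 1)) :
    (piece φ j).toOrderHom t ≤ φ.toOrderHom j.succ := by
  rw [Fin.le_def, piece_val, ← add_gap]
  exact Nat.add_le_add_left (Nat.lt_succ_iff.mp t.isLt) _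

lemma piece_le_of_lt {j j' : Fin m} (h : j < j') (t : Fin (gap φ j + 1)) :
    (piece φ j).toOrderHom t ≤ φ.toOrderHom j'.castSucc :=
  (piece_le_succ φ j t).trans (φ.toOrderHom.monotone h)

lemma eq_zero_of_piece_eq {j : Fin m} {t : Fin (gap φ j + 1)}
    (h : (piece φ j).toOrderHom t = φ.toOrderHom j.castSucc) : t = 0 := by
  have := congrArg Fin.val h
  rw [piece_val] at this
  exact Fin.ext (by simpa using this)

lemma eq_last_of_piece_eq {j : Fin m} {t : Fin (gap φ j + 1)}
    (h : (piece φ j).toOrderHom t = φ.toOrderHom j.succ) : t = Fin.last _ := by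
  have := congrArg Fin.val h
  rw [piece_val, ← add_gap] at this
  exact Fin.ext (by simpa using this)

lemma exists_greatest_le (hφ : IsActive φ) (i : Fin (n + 1)) :
    ∃ k : Fin (m + 1), φ.toOrderHom k ≤ i ∧ ∀ k', φ.toOrderHom k' ≤ i → k' ≤ k := by
  obtain ⟨k, hk, hk'⟩ := (Set.toFinite {k | φ.toOrderHom k ≤ i}).exists_maximal
    ⟨0, hφ.1.le.trans i.zero_le⟩
  refine ⟨k, hk, fun k' h ↦ ?_⟩
  rcases le_total k' k with h' | h'
  · exact h'
  · exact hk' h h'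

/-- Consecutive elements of `[n]` lie in a common piece. -/
lemma exists_piece_succ (hφ : IsActive φ) (i : Fin n) :
    ∃ (j : Fin m) (t : Fin (gap φ j)), (piece φ j).toOrderHom t.castSucc = i.castSucc ∧
      (piece φ j).toOrderHom t.succ = i.succ := by
  obtain ⟨k, hk, hk'⟩ := exists_greatest_le φ hφ i.castSucc
  induction k using Fin.lastCases with
  | last =>
    rw [hφ.2] at hk
    exact absurd (i.castSucc_lt_last) hk.not_gt
  | cast j =>
    have h : i.castSucc < φ.toOrderHom j.succ :=
      not_le.mp fun h ↦ (hk' _ h).not_gt j.castSucc_lt_succ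
    have h₁ : (φ.toOrderHom j.castSucc : ℕ) ≤ i := hk
    have h₂ : (i : ℕ) < φ.toOrderHom j.succ := h
    rw [← add_gap] at h₂
    refine ⟨j, ⟨i - φ.toOrderHom j.castSucc, by omega⟩, Fin.ext ?_, Fin.ext ?_⟩
    · rw [piece_val]
      simp only [Fin.val_castSucc]
      omega
    · rw [piece_val]
      simp only [Fin.val_succ]
      omega

/-- The piece in which two consecutive elements of `[n]` lie is unique. -/
lemma piece_succ_unique {j j' : Fin m} {t : Fin (gap φ j)} {t' : Fin (gap φ j')}
    (h : (piece φ j).toOrderHom t.castSucc = (piece φ j').toOrderHom t'.castSucc) : j = j' := by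
  have key {j j' : Fin m} {t : Fin (gap φ j)} {t' : Fin (gap φ j')}
      (h : (piece φ j).toOrderHom t.castSucc = (piece φ j').toOrderHom t'.castSucc) :
      ¬ j < j' := fun hj ↦ by
    have h₁ := piece_le_of_lt φ hj t.succ
    have h₂ := h₁.trans (castSucc_le_piece φ j' t'.castSucc)
    rw [← h, Fin.le_def, piece_val, piece_val, Fin.val_succ, Fin.val_castSucc] at h₂
    omega
  exact le_antisymm (not_lt.mp (key h.symm)) (not_lt.mp (key h))

/-- Every element of `[n]` outside the image of an active map lies in some piece, which is unique by
`piece_unique_of_not_mem_range`. -/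
lemma exists_piece_of_not_mem_range (hφ : IsActive φ) (i : Fin (n + 1))
    (hi : ∀ k, φ.toOrderHom k ≠ i) :
    ∃ (j : Fin m) (t : Fin (gap φ j + 1)), (piece φ j).toOrderHom t = i := by
  induction i using Fin.lastCases with
  | last => exact absurd hφ.2 (hi _)
  | cast i =>
    obtain ⟨j, t, h, -⟩ := exists_piece_succ φ hφ i
    exact ⟨j, _, h⟩

lemma piece_unique_of_not_mem_range {j j' : Fin m} {t : Fin (gap φ j + 1)}
    {t' : Fin (gap φ j' + 1)} (h : (piece φ j).toOrderHom t = (piece φ j').toOrderHom t')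
    (hi : ∀ k, φ.toOrderHom k ≠ (piece φ j).toOrderHom t) : j = j' := by
  refine le_antisymm (not_lt.mp fun hj ↦ hi j.castSucc ?_) (not_lt.mp fun hj ↦ hi j'.castSucc ?_)
  · exact (castSucc_le_piece φ j t).antisymm (h.le.trans (piece_le_of_lt φ hj t'))
  · exact ((piece_le_of_lt φ hj t).antisymm (h ▸ castSucc_le_piece φ j' t')).symm

end Pieces

/-! ### Gluing morphisms of chains along an active map -/

namespace FinChain

variable {m n : ℕ} {φ : ⦋m⦌ ⟶ ⦋n⦌} {ξ : FinChain ⦋m⦌} {A B : FinChain ⦋n⦌}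

/-- Let `v : ξ ⟶ φ^* A` be an isomorphism. At a single vertex `i`, the value of a morphism out
of `A` is determined consistently by its restrictions to the pieces containing `i` and by its
composites with `v` over `i`. -/
lemma exists_glue_at (hφ : IsActive φ) (v : ξ ⟶ (pull φ).obj A) (w : ξ ⟶ (pull φ).obj B)
    (hv : ∀ k, Function.Surjective (Hom.ap v k))
    (g : ∀ j : Fin m, (pull (piece φ j)).obj A ⟶ (pull (piece φ j)).obj B)
    (hg : ∀ (j : Fin m) (l : Fin 2) (x : ξ.El ((SimplexCategory.mkOfSucc j).toOrderHom l)),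
      Hom.ap (g j) ((SimplexCategory.diag (gap φ j)).toOrderHom l)
        (A.act (piece_diag φ j l).ge (Hom.ap v _ x)) =
          B.act (piece_diag φ j l).ge (Hom.ap w _ x))
    (i : Fin (n + 1)) :
    ∃ h : A.El i → B.El i, Function.Injective h ∧
      (∀ (j : Fin m) (t : Fin (gap φ j + 1)) (e : (piece φ j).toOrderHom t = i)
        (x : A.El ((piece φ j).toOrderHom t)),
        h (A.act e.le x) = B.act e.le (Hom.ap (g j) t x)) ∧
      ∀ (k : Fin (m + 1)) (e : φ.toOrderHom k = i) (x : ξ.El k),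
        h (A.act e.le (Hom.ap v k x)) = B.act e.le (Hom.ap w k x) := by
  by_cases hi : ∃ k, φ.toOrderHom k = i
  · obtain ⟨k, hk, hk'⟩ := exists_greatest_le φ hφ i
    obtain rfl : φ.toOrderHom k = i := by
      obtain ⟨k', rfl⟩ := hi
      exact hk.antisymm (φ.toOrderHom.monotone (hk' _ le_rfl))
    -- over `φ k`, with `k` as large as possible, `h` has to be `w ∘ v⁻¹`
    let ev := Equiv.ofBijective _ ⟨Hom.ap_injective v k, hv k⟩
    have hev (x : ξ.El k) : ev.symm (Hom.ap v k x) = x := ev.symm_apply_apply x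
    have hw (k' : Fin (m + 1)) (e : φ.toOrderHom k' = φ.toOrderHom k) (x : ξ.El k') :
        Hom.ap w k (ev.symm (A.act e.le (Hom.ap v k' x))) = B.act e.le (Hom.ap w k' x) := by
      have h₁ : A.act e.le (Hom.ap v k' x) = Hom.ap v k (ξ.act (hk' _ e.le) x) :=
        (Hom.ap_act v (hk' _ e.le) x).symm
      exact (congrArg (Hom.ap w k) ((congrArg ev.symm h₁).trans (hev _))).trans
        (Hom.ap_act w (hk' _ e.le) x)
    refine ⟨fun y ↦ Hom.ap w k (ev.symm y),
      (Hom.ap_injective w k).comp ev.symm.injective, fun j t e x ↦ ?_, hw⟩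
    obtain ⟨l, rfl⟩ : ∃ l : Fin 2, (SimplexCategory.diag (gap φ j)).toOrderHom l = t := by
      rcases le_or_gt k j.castSucc with h | h
      · refine ⟨0, (eq_zero_of_piece_eq φ (le_antisymm ?_ (castSucc_le_piece φ j t))).symm⟩
        exact e.le.trans (φ.toOrderHom.monotone h)
      · refine ⟨1, (eq_last_of_piece_eq φ (le_antisymm (piece_le_succ φ j t) ?_)).symm⟩
        exact (φ.toOrderHom.monotone h).trans e.ge
    obtain ⟨y, rfl⟩ := (A.act_bijective_of_eq (piece_diag φ j l).ge (piece_diag φ j l).symm).2 x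
    obtain ⟨z, rfl⟩ := hv _ y
    have e' := (piece_diag φ j l).symm.trans e
    refine Eq.trans ?_ (congrArg (B.act e.le) (hg j l z).symm)
    refine Eq.trans ?_ ((hw _ e' z).trans (B.act_act _ _ _).symm)
    exact congrArg (fun t ↦ Hom.ap w k (ev.symm t)) (A.act_act _ _ _)
  · push Not at hi
    obtain ⟨j, t, rfl⟩ := exists_piece_of_not_mem_range φ hφ i hi
    refine ⟨Hom.ap (g j) t, Hom.ap_injective (g j) t, fun j' t' e x ↦ ?_,
      fun k e ↦ absurd e (hi k)⟩
    obtain rfl := piece_unique_of_not_mem_range φ e.symm hi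
    obtain rfl : t' = t := Fin.ext (by simpa [piece_val] using congrArg Fin.val e)
    exact (congrArg _ (A.act_refl _ x)).trans (B.act_refl _ _).symm

/-- Morphisms out of a chain `A` with an isomorphism `v : ξ ⟶ φ^* A` can be glued from morphisms
on the pieces cut out by the active map `φ`. -/
lemma exists_glue (hφ : IsActive φ) (v : ξ ⟶ (pull φ).obj A) (w : ξ ⟶ (pull φ).obj B)
    (hv : ∀ k, Function.Surjective (Hom.ap v k))
    (g : ∀ j : Fin m, (pull (piece φ j)).obj A ⟶ (pull (piece φ j)).obj B)
    (hg : ∀ (j : Fin m) (l : Fin 2) (x : ξ.El ((SimplexCategory.mkOfSucc j).toOrderHom l)),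
      Hom.ap (g j) ((SimplexCategory.diag (gap φ j)).toOrderHom l)
        (A.act (piece_diag φ j l).ge (Hom.ap v _ x)) =
          B.act (piece_diag φ j l).ge (Hom.ap w _ x)) :
    ∃ h : A ⟶ B, (∀ j, (pull (piece φ j)).map h = g j) ∧ v ≫ (pull φ).map h = w := by
  choose h h_inj h_piece h_vert using exists_glue_at hφ v w hv g hg
  refine ⟨homMkSucc (n := ⦋n⦌) h h_inj (fun i x ↦ ?_) (fun i x y hxy ↦ ?_),
    fun j ↦ Hom.ext_ap fun t x ↦ ?_, Hom.ext_ap fun k x ↦ ?_⟩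
  · obtain ⟨j, t, e, e'⟩ := exists_piece_succ φ hφ i
    obtain ⟨x, rfl⟩ := (A.act_bijective_of_eq e.le e).2 x
    have hx := h_piece _ j t.succ e' (((pull (piece φ j)).obj A).act t.castSucc_le_succ x)
    refine (congrArg (h _) ((A.act_act _ _ _).trans (A.act_act _ _ _).symm)).trans (hx.trans ?_)
    refine (congrArg (B.act e'.le) (Hom.ap_act (g j) t.castSucc_le_succ x)).trans ?_
    exact ((B.act_act _ _ _).trans (B.act_act _ _ _).symm).trans
      (congrArg (B.act _) (h_piece _ j _ e x).symm)
  · obtain ⟨j, t, e, e'⟩ := exists_piece_succ φ hφ i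
    obtain ⟨x, rfl⟩ := (B.act_bijective_of_eq e.le e).2 x
    obtain ⟨y, rfl⟩ := (A.act_bijective_of_eq e'.le e').2 y
    obtain ⟨a, rfl⟩ := Hom.exists_ap_eq (g j) t.castSucc_le_succ x y <|
      (B.act_bijective_of_eq e'.le e').1 <| (h_piece _ j _ e' y).symm.trans <|
        hxy.trans ((B.act_act _ _ _).trans (B.act_act _ _ _).symm)
    exact ⟨A.act e.le a, h_piece _ j _ e a⟩
  · exact (congrArg (h _) (A.act_refl _ x).symm).trans
      ((h_piece _ j t rfl x).trans (B.act_refl _ _))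
  · exact (congrArg (h _) (A.act_refl _ _).symm).trans
      ((h_vert _ k rfl x).trans (B.act_refl _ _))

/-- Morphisms out of such a chain are determined by their restrictions to the pieces and their
composites with `v`. -/
lemma glue_unique (hφ : IsActive φ) (v : ξ ⟶ (pull φ).obj A)
    (hv : ∀ k, Function.Surjective (Hom.ap v k)) {h h' : A ⟶ B}
    (hp : ∀ j, (pull (piece φ j)).map h = (pull (piece φ j)).map h')
    (hh : v ≫ (pull φ).map h = v ≫ (pull φ).map h') : h = h' := by
  refine Hom.ext_ap fun i x ↦ ?_
  by_cases hi : ∃ k, φ.toOrderHom k = i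
  · obtain ⟨k, rfl⟩ := hi
    obtain ⟨x, rfl⟩ := hv k x
    exact congrArg (fun t ↦ Hom.ap t k x) hh
  · push Not at hi
    obtain ⟨j, t, rfl⟩ := exists_piece_of_not_mem_range φ hφ i hi
    exact congrArg (fun s ↦ Hom.ap s t x) (hp j)

end FinChain

/-! ### Gluing chains along an active map -/

namespace FinChain

variable {m n : ℕ} {φ : ⦋m⦌ ⟶ ⦋n⦌} {ξ : FinChain ⦋m⦌}

/-- If every `ξ_j` is isomorphic to the restriction of a chain of length `φ(j + 1) - φ(j)` to its
end points, then `ξ` is constant up to isomorphism where `φ` is constant. -/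
lemma act_bijective_of_map_eq (E : ∀ j : Fin m, FinChain ⦋gap φ j⦌)
    (u : ∀ j, (pull (SimplexCategory.mkOfSucc j)).obj ξ ⟶
      (pull (SimplexCategory.diag (gap φ j))).obj (E j))
    (hu : ∀ j l, Function.Surjective (Hom.ap (u j) l)) {k k' : Fin (m + 1)} (h : k ≤ k')
    (h' : φ.toOrderHom k = φ.toOrderHom k') : Function.Bijective (ξ.act h) := by
  induction k' using Fin.induction with
  | zero => exact ξ.act_bijective_of_eq h (Fin.le_zero_iff.mp h)
  | succ j ih =>
    rcases h.eq_or_lt with rfl | h₁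
    · exact ξ.act_bijective_of_eq h rfl
    have h₂ : k ≤ j.castSucc := Fin.le_castSucc_iff.mpr h₁
    have h₃ : φ.toOrderHom j.castSucc = φ.toOrderHom j.succ :=
      (φ.toOrderHom.monotone j.castSucc_le_succ).antisymm (h' ▸ φ.toOrderHom.monotone h₂)
    have hj : Function.Bijective (ξ.act j.castSucc_le_succ) := by
      have hb (l) : Function.Bijective (Hom.ap (u j) l) := ⟨Hom.ap_injective _ _, hu j l⟩
      refine ((hb 1).of_comp_iff' (ξ.act j.castSucc_le_succ)).mp ?_
      have hd : (SimplexCategory.diag (gap φ j)).toOrderHom 0 =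
          (SimplexCategory.diag (gap φ j)).toOrderHom 1 := by
        refine Fin.ext ?_
        have := add_gap φ j
        rw [h₃] at this
        change 0 = gap φ j
        omega
      have := ((E j).act_bijective_of_eq hd.le hd).comp (hb 0)
      refine Eq.subst (motive := Function.Bijective) ?_ this
      exact funext fun x ↦ (Hom.ap_act (u j) (i := 0) (j := 1) (by simp) x).symm
    have := hj.comp (ih h₂ (h'.trans h₃.symm))
    convert this using 1
    exact funext fun x ↦ (ξ.act_act _ _ x).symm

/-- The set of the glued chain at a single vertex `i`, with its identifications with the sets of
`ξ` over `i` and with the sets at `i` of the pieces. -/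
lemma exists_glue_set (hφ : IsActive φ) (E : ∀ j : Fin m, FinChain ⦋gap φ j⦌)
    (u : ∀ j, (pull (SimplexCategory.mkOfSucc j)).obj ξ ⟶
      (pull (SimplexCategory.diag (gap φ j))).obj (E j))
    (hu : ∀ j l, Function.Surjective (Hom.ap (u j) l)) (i : Fin (n + 1)) :
    ∃ (T : FintypeCat.Skeleton.{0})
      (a : ∀ k, φ.toOrderHom k = i → ξ.El k → ULift.{0} (Fin T.len))
      (b : ∀ j t, (piece φ j).toOrderHom t = i → (E j).El t → ULift.{0} (Fin T.len)),
      (∀ k e, Function.Bijective (a k e)) ∧ (∀ j t e, Function.Bijective (b j t e)) ∧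
      ∀ j l e e' x, b j ((SimplexCategory.diag (gap φ j)).toOrderHom l) e' (Hom.ap (u j) l x) =
        a ((SimplexCategory.mkOfSucc j).toOrderHom l) e x := by
  by_cases hi : ∃ k, φ.toOrderHom k = i
  · obtain ⟨k, hk, hk'⟩ := exists_greatest_le φ hφ i
    obtain rfl : φ.toOrderHom k = i := by
      obtain ⟨k', rfl⟩ := hi
      exact hk.antisymm (φ.toOrderHom.monotone (hk' _ le_rfl))
    -- over `φ k`, with `k` as large as possible, the glued set is that of `ξ` at `k`
    have ha (k' : Fin (m + 1)) (e : φ.toOrderHom k' = φ.toOrderHom k) :=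
      act_bijective_of_map_eq E u hu (hk' k' e.le) e
    have key (j : Fin m) (t : Fin (gap φ j + 1)) (e : (piece φ j).toOrderHom t = φ.toOrderHom k) :
        ∃ b : (E j).El t → ξ.El k, Function.Bijective b ∧
          ∀ (l : Fin 2) (h : (SimplexCategory.diag (gap φ j)).toOrderHom l = t)
            (x : ξ.El ((SimplexCategory.mkOfSucc j).toOrderHom l)),
            b ((E j).act h.le (Hom.ap (u j) l x)) =
              ξ.act (hk' _ (by rw [← e, ← piece_diag, h])) x := by
      -- `t` is an end point of the piece; let `l₀` be the greatest vertex of `[1]` which goes to it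
      obtain ⟨l₀, rfl, hl₀⟩ : ∃ l₀ : Fin 2, (SimplexCategory.diag (gap φ j)).toOrderHom l₀ = t ∧
          ∀ l, (SimplexCategory.diag (gap φ j)).toOrderHom l = t → l ≤ l₀ := by
        rcases le_or_gt k j.castSucc with h | h
        · obtain rfl : t = 0 := eq_zero_of_piece_eq φ (le_antisymm
            (e.le.trans (φ.toOrderHom.monotone h)) (castSucc_le_piece φ j t))
          refine ⟨0, rfl, fun l hl ↦ ?_⟩
          match l with
          | 0 => exact le_rfl
          | 1 =>
            have h₁ : φ.toOrderHom j.succ = φ.toOrderHom k := by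
              rw [← e, ← hl]
              exact (piece_diag φ j 1).symm
            exact absurd ((hk' _ h₁.le).trans h) (not_le.mpr j.castSucc_lt_succ)
        · exact ⟨1, (eq_last_of_piece_eq φ (le_antisymm (piece_le_succ φ j t)
            ((φ.toOrderHom.monotone h).trans e.ge))).symm, fun l _ ↦ Fin.le_last l⟩
      have e' := (piece_diag φ j l₀).symm.trans e
      let eu := Equiv.ofBijective _ ⟨Hom.ap_injective (u j) l₀, hu j l₀⟩
      have heu (x) : eu.symm (Hom.ap (u j) l₀ x) = x := eu.symm_apply_apply x
      refine ⟨fun y ↦ ξ.act (hk' _ e'.le) (eu.symm y),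
        (ha _ e').comp eu.symm.bijective, fun l h x ↦ ?_⟩
      have h₁ : (E j).act h.le (Hom.ap (u j) l x) =
          Hom.ap (u j) l₀ (((pull (SimplexCategory.mkOfSucc j)).obj ξ).act (hl₀ l h) x) :=
        (Hom.ap_act (u j) (hl₀ l h) x).symm
      exact (congrArg (ξ.act _) ((congrArg eu.symm h₁).trans (heu _))).trans (ξ.act_act _ _ _)
    choose b hb hb' using key
    refine ⟨ξ.functor.obj k, fun k' e ↦ ξ.act (hk' k' e.le), b, ha, hb, fun j l e e' x ↦ ?_⟩
    exact (congrArg (b j _ e') ((E j).act_refl le_rfl _).symm).trans (hb' j _ e' l rfl x)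
  · push Not at hi
    obtain ⟨j, t, rfl⟩ := exists_piece_of_not_mem_range φ hφ i hi
    have key (j' : Fin m) (t' : Fin (gap φ j' + 1))
        (e : (piece φ j').toOrderHom t' = (piece φ j).toOrderHom t) :
        ∃ b : (E j').El t' → (E j).El t, Function.Bijective b := by
      obtain rfl := piece_unique_of_not_mem_range φ e.symm hi
      obtain rfl : t' = t := Fin.ext (by simpa [piece_val] using congrArg Fin.val e)
      exact ⟨id, Function.bijective_id⟩
    choose b hb using key
    exact ⟨(E j).functor.obj t, fun k e ↦ absurd e (hi k), b, fun k e ↦ absurd e (hi k), hb,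
      fun j l e ↦ absurd e (hi _)⟩

/-- Chains on the pieces cut out by the active map `φ` whose end points are identified with those
of the `ξ_j` can be glued. -/
lemma exists_glue_chain (hφ : IsActive φ) (E : ∀ j : Fin m, FinChain ⦋gap φ j⦌)
    (u : ∀ j, (pull (SimplexCategory.mkOfSucc j)).obj ξ ⟶
      (pull (SimplexCategory.diag (gap φ j))).obj (E j))
    (hu : ∀ j l, Function.Surjective (Hom.ap (u j) l)) :
    ∃ (V : FinChain ⦋n⦌) (v : ξ ⟶ (pull φ).obj V) (θ : ∀ j, (pull (piece φ j)).obj V ⟶ E j),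
      (∀ k, Function.Surjective (Hom.ap v k)) ∧
      ∀ (j : Fin m) (l : Fin 2) (x : ξ.El ((SimplexCategory.mkOfSucc j).toOrderHom l)),
        Hom.ap (θ j) ((SimplexCategory.diag (gap φ j)).toOrderHom l)
          (V.act (piece_diag φ j l).ge (Hom.ap v _ x)) = Hom.ap (u j) l x := by
  choose T a b ha hb hab using exists_glue_set hφ E u hu
  choose J τ hJ hJ' using exists_piece_succ φ hφ
  let β (j : Fin m) (t : Fin (gap φ j + 1)) (i) (e : (piece φ j).toOrderHom t = i) :=
    Equiv.ofBijective _ (hb i j t e)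
  -- consecutive vertices lie in a unique piece, which provides the map between their sets
  let σ (i : Fin n) : T i.castSucc ⟶ T i.succ := fun x ↦
    β _ _ _ (hJ' i) ((E (J i)).act (τ i).castSucc_le_succ ((β _ _ _ (hJ i)).symm x))
  let V : FinChain ⦋n⦌ := ⟨ComposableArrows.mkOfObjOfMapSucc T σ⟩
  have hV (i : Fin n) (x : V.El i.castSucc) : V.act i.castSucc_le_succ x = σ i x :=
    congrFun (ComposableArrows.mkOfObjOfMapSucc_map_succ T σ i.1 i.2) x
  have hσ (j : Fin m) (t : Fin (gap φ j)) {p q : Fin (n + 1)}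
      (hp : (piece φ j).toOrderHom t.castSucc = p) (hq : (piece φ j).toOrderHom t.succ = q)
      (hpq : p ≤ q) (y : (E j).El t.castSucc) :
      V.act hpq (β j _ p hp y) = β j _ q hq ((E j).act t.castSucc_le_succ y) := by
    obtain ⟨i, rfl, rfl⟩ : ∃ i : Fin n, p = i.castSucc ∧ q = i.succ := by
      have hp' := (congrArg Fin.val hp).symm.trans (piece_val φ j _)
      have hq' := (congrArg Fin.val hq).symm.trans (piece_val φ j _)
      rw [Fin.val_castSucc] at hp'
      rw [Fin.val_succ] at hq'
      have := q.isLt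
      exact ⟨⟨p, by omega⟩, Fin.ext rfl, Fin.ext (by rw [Fin.val_succ]; simp only []; omega)⟩
    obtain rfl := piece_succ_unique φ ((hJ i).trans hp.symm)
    obtain rfl : t = τ i := by
      have := congrArg Fin.val (hp.trans (hJ i).symm)
      rw [piece_val, piece_val] at this
      exact Fin.ext (by simpa using this)
    refine (hV i _).trans (congrArg (fun z ↦ β _ _ _ hq ((E (J i)).act _ z)) ?_)
    exact Equiv.symm_apply_apply _ _
  let θ (j : Fin m) : (pull (piece φ j)).obj V ⟶ E j :=
    homMkSucc (n := ⦋gap φ j⦌) (fun t ↦ (β j t _ rfl).symm) (fun t ↦ (β j t _ rfl).symm.injective)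
      (fun t x ↦ by
        refine (Equiv.symm_apply_eq _).mpr ?_
        refine Eq.trans ?_ (hσ j t rfl rfl ((piece φ j).toOrderHom.monotone t.castSucc_le_succ) _)
        exact congrArg (V.act _) (Equiv.apply_symm_apply _ _).symm)
      (fun t x _ _ ↦ ⟨β j _ _ rfl x, Equiv.symm_apply_apply _ _⟩)
  have hθ (j : Fin m) {s t : Fin (gap φ j + 1)} (h : s ≤ t) {p q : Fin (n + 1)}
      (hp : (piece φ j).toOrderHom s = p) (hq : (piece φ j).toOrderHom t = q) (hpq : p ≤ q)
      (y : (E j).El s) : V.act hpq (β j s p hp y) = β j t q hq ((E j).act h y) := by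
    subst hp hq
    refine (Equiv.symm_apply_eq _).mp ?_
    refine (Hom.ap_act (θ j) h _).trans (congrArg ((E j).act h) ?_)
    exact Equiv.symm_apply_apply _ _
  have hab' (j : Fin m) (l : Fin 2) (x : ξ.El ((SimplexCategory.mkOfSucc j).toOrderHom l)) :
      β j _ _ (piece_diag φ j l) (Hom.ap (u j) l x) =
        a _ ((SimplexCategory.mkOfSucc j).toOrderHom l) rfl x :=
    hab _ j l rfl (piece_diag φ j l) x
  let v : ξ ⟶ (pull φ).obj V :=
    homMkSucc (n := ⦋m⦌) (fun k ↦ a _ k rfl) (fun k ↦ (ha _ k rfl).1)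
      (fun j x ↦ by
        have h : (SimplexCategory.diag (gap φ j)).toOrderHom 0 ≤
            (SimplexCategory.diag (gap φ j)).toOrderHom 1 :=
          (SimplexCategory.diag (gap φ j)).toOrderHom.monotone (Fin.zero_le 1)
        refine Eq.trans ?_ (congrArg (V.act _) (hab' j 0 x))
        refine Eq.trans ?_ (hθ j h (piece_diag φ j 0) (piece_diag φ j 1)
          (φ.toOrderHom.monotone j.castSucc_le_succ) _).symm
        refine Eq.trans (hab' j 1 _).symm (congrArg (β j _ _ (piece_diag φ j 1)) ?_)
        exact Hom.ap_act (u j) (i := 0) (j := 1) (by simp) x)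
      (fun j x _ _ ↦ (ha _ _ rfl).2 x)
  refine ⟨V, v, θ, fun k ↦ (ha _ k rfl).2, fun j l x ↦ ?_⟩
  refine (Equiv.symm_apply_eq _).mpr ?_
  refine (congrArg (V.act _) (hab' j l x).symm).trans ((hθ j le_rfl _ rfl _ _).trans ?_)
  exact congrArg _ ((E j).act_refl _ _)

end FinChain

/-! ### Admissibility -/

namespace DeltaF

open FinChain

variable {m n : ℕ} {φ : ⦋m⦌ ⟶ ⦋n⦌} {ξ : fibre.obj (op ⦋m⦌)}

/-- The chain of an object under `ξ`. -/
def chainOf {a b : SimplexCategory} {ψ : a ⟶ b} {ζ : fibre.obj (op a)}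
    (c : StructuredArrow ζ (reindex fibre ψ)) : FinChain b :=
  c.right

/-- The structure morphism of an object under `ξ`, as a morphism of chains. -/
def homOf {a b : SimplexCategory} {ψ : a ⟶ b} {ζ : fibre.obj (op a)}
    (c : StructuredArrow ζ (reindex fibre ψ)) :
    (show FinChain a from ζ) ⟶ (pull ψ).obj (chainOf c) :=
  c.hom

/-- The morphism of chains of a morphism of objects under `ξ`. -/
def chainMap {a b : SimplexCategory} {ψ : a ⟶ b} {ζ : fibre.obj (op a)}
    {c d : StructuredArrow ζ (reindex fibre ψ)} (f : c ⟶ d) : chainOf c ⟶ chainOf d :=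
  f.right

lemma homOf_chainMap {a b : SimplexCategory} {ψ : a ⟶ b} {ζ : fibre.obj (op a)}
    {c d : StructuredArrow ζ (reindex fibre ψ)} (f : c ⟶ d) :
    homOf c ≫ (pull ψ).map (chainMap f) = homOf d :=
  StructuredArrow.w f

lemma exists_chainMap_eq {a b : SimplexCategory} {ψ : a ⟶ b} {ζ : fibre.obj (op a)}
    {c d : StructuredArrow ζ (reindex fibre ψ)} (f : chainOf c ⟶ chainOf d)
    (h : homOf c ≫ (pull ψ).map f = homOf d) : ∃ g : c ⟶ d, chainMap g = f :=
  ⟨StructuredArrow.homMk f h, rfl⟩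

lemma chainMap_injective {a b : SimplexCategory} {ψ : a ⟶ b} {ζ : fibre.obj (op a)}
    {c d : StructuredArrow ζ (reindex fibre ψ)} {f g : c ⟶ d} (h : chainMap f = chainMap g) :
    f = g :=
  StructuredArrow.hom_ext _ _ h

/-- The structure morphisms of the components of the comparison functor, on elements. -/
lemma homOf_comparison_ap (c : StructuredArrow ξ (reindex fibre φ))
    (j : Fin m) (l : Fin 2)
    (x : FinChain.El (n := ⦋m⦌) ξ ((SimplexCategory.mkOfSucc j).toOrderHom l)) :
    Hom.ap (homOf ((comparison fibre φ ξ).obj c j)) l x =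
      (chainOf c).act (piece_diag φ j l).ge (Hom.ap (homOf c) _ x) := by
  have e : ((comparison fibre φ ξ).obj c j).hom =
      (reindex fibre (SimplexCategory.mkOfSucc j)).map c.hom ≫
        (reindexSquare fibre (piece_eq φ j)).hom.app c.right :=
    Category.id_comp _
  exact (congrFun (congrArg (fun t ↦ Hom.ap (n := ⦋1⦌)
    (A := (pull (SimplexCategory.mkOfSucc j)).obj ξ)
    (B := (pull (SimplexCategory.diag (gap φ j))).obj ((pull (piece φ j)).obj c.right)) t l) e)
    x).trans (reindexSquare_ap (piece_eq φ j) c.right l _)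

/-- The comparison functor is fully faithful on morphisms out of objects `c₀` for which `ξ ⟶ φ^* c₀`
is an isomorphism. -/
lemma comparison_map_bijective (hφ : IsActive φ) {c₀ c : StructuredArrow ξ (reindex fibre φ)}
    (hc : ∀ k, Function.Surjective (Hom.ap (homOf c₀) k)) :
    Function.Bijective ((comparison fibre φ ξ).map : (c₀ ⟶ c) → _) := by
  refine ⟨fun f f' h ↦ chainMap_injective (glue_unique hφ (homOf c₀) hc (fun j ↦ ?_) ?_),
    fun g ↦ ?_⟩
  · exact congrArg chainMap (congrFun h j)
  · rw [homOf_chainMap, homOf_chainMap]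
  · obtain ⟨h, hh, hw⟩ := exists_glue hφ (homOf c₀) (homOf c) hc (fun j ↦ chainMap (g j))
      fun j l x ↦ by
        have := congrArg (fun t ↦ Hom.ap t l x) (homOf_chainMap (g j))
        exact ((congrArg (Hom.ap (chainMap (g j)) _) (homOf_comparison_ap c₀ j l x)).symm.trans
          this).trans (homOf_comparison_ap c j l x)
    obtain ⟨f, rfl⟩ := exists_chainMap_eq h hw
    exact ⟨f, funext fun j ↦ chainMap_injective (hh j)⟩

/-- Every object of the product has a coreflection from the image of an object `c₀` for which
`ξ ⟶ φ^* c₀` is an isomorphism. -/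
lemma exists_coreflection (hφ : IsActive φ)
    (d : ∀ j : Fin m, StructuredArrow ((reindex fibre (SimplexCategory.mkOfSucc j)).obj ξ)
      (reindex fibre (SimplexCategory.diag (gap φ j)))) :
    ∃ (c₀ : StructuredArrow ξ (reindex fibre φ)) (α : (comparison fibre φ ξ).obj c₀ ⟶ d),
      (∀ k, Function.Surjective (Hom.ap (homOf c₀) k)) ∧
      ∀ c₁ : StructuredArrow ξ (reindex fibre φ),
        (∀ k, Function.Surjective (Hom.ap (homOf c₁) k)) →
        Function.Bijective fun h : c₁ ⟶ c₀ ↦ (comparison fibre φ ξ).map h ≫ α := by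
  -- restrict each chain of `d` to the image of `ξ_j` in its last set
  choose E e he using fun j ↦ exists_restriction (chainOf (d j))
    (Set.range (Hom.ap (homOf (d j)) (1 : Fin 2)))
  have hu (j : Fin m) : ∃ u : (pull (SimplexCategory.mkOfSucc j)).obj ξ ⟶
      (pull (SimplexCategory.diag (gap φ j))).obj (E j),
      u ≫ (pull (SimplexCategory.diag (gap φ j))).map (e j) = homOf (d j) :=
    exists_factorization (n := ⦋1⦌) ((pull (SimplexCategory.diag (gap φ j))).map (e j))
      (homOf (d j)) fun x ↦ (he j).ge ⟨x, rfl⟩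
  choose u hu using hu
  have hu' (j l) : Function.Surjective (Hom.ap (u j) l) := by
    refine surjective_of_last (n := ⦋1⦌) (u j) (fun y ↦ ?_) l
    obtain ⟨x, hx⟩ := (he j).le ⟨y, rfl⟩
    refine ⟨x, Hom.ap_injective (e j) _ ?_⟩
    exact (congrArg (fun t ↦ Hom.ap t (1 : Fin 2) x) (hu j)).trans hx
  obtain ⟨V, v, θ, hv, hθu⟩ := exists_glue_chain hφ E u hu'
  let c₀ : StructuredArrow ξ (reindex fibre φ) := StructuredArrow.mk (Y := V) v
  have hα (j : Fin m) : ∃ α : (comparison fibre φ ξ).obj c₀ j ⟶ d j, chainMap α = θ j ≫ e j := by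
    refine exists_chainMap_eq _ (Hom.ext_ap fun l x ↦ ?_)
    refine Eq.trans ?_ (congrArg (fun t ↦ Hom.ap t l x) (hu j))
    refine congrArg (Hom.ap (e j) _) (Eq.trans ?_ (hθu j l x))
    exact congrArg (Hom.ap (θ j) _) (homOf_comparison_ap c₀ j l x)
  choose α hα using hα
  refine ⟨c₀, α, hv, fun c₁ hc₁ ↦ Function.Bijective.comp (g := fun h ↦ h ≫ α) ⟨?_, ?_⟩
    (comparison_map_bijective hφ hc₁)⟩
  · intro f f' h
    refine funext fun j ↦ chainMap_injective ?_
    have hj : chainMap (f j) ≫ chainMap (α j) = chainMap (f' j) ≫ chainMap (α j) :=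
      congrArg chainMap (congrFun h j)
    exact (cancel_mono _).mp hj
  · intro β
    have key (j : Fin m) : ∃ γ : (comparison fibre φ ξ).obj c₁ j ⟶ (comparison fibre φ ξ).obj c₀ j,
        γ ≫ α j = β j := by
      obtain ⟨γ, hγ⟩ := exists_factorization (chainMap (α j)) (chainMap (β j)) fun x ↦ by
        obtain ⟨y, rfl⟩ := ((chainOf c₁).act_bijective_of_eq (piece_diag φ j 1).ge
          (piece_diag φ j 1).symm).2 x
        obtain ⟨z, rfl⟩ := hc₁ _ y
        refine ⟨Hom.ap (homOf ((comparison fibre φ ξ).obj c₀ j)) (1 : Fin 2) z, ?_⟩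
        have h₀ := congrArg (fun t ↦ Hom.ap t (1 : Fin 2) z) (homOf_chainMap (α j))
        have h₁ := congrArg (fun t ↦ Hom.ap t (1 : Fin 2) z) (homOf_chainMap (β j))
        exact h₀.trans (h₁.symm.trans
          (congrArg (Hom.ap (chainMap (β j)) _) (homOf_comparison_ap c₁ j 1 z)))
      obtain ⟨γ, rfl⟩ := exists_chainMap_eq γ (by
        rw [← cancel_mono ((pull _).map (chainMap (α j))), Category.assoc, homOf_chainMap,
          ← Functor.map_comp, hγ, homOf_chainMap])
      exact ⟨γ, chainMap_injective hγ⟩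
    choose γ hγ using key
    exact ⟨γ, funext hγ⟩

/-- The fibres of `Δ_𝔽` are admissible: the objects `η` for which `ξ ⟶ φ^* η` is an isomorphism
form a class to which `isCoinitial_of_coreflections` applies. -/
theorem isAdmissible_fibre : IsAdmissible fibre := fun m n φ hφ ξ ↦
  isCoinitial_of_coreflections _ (fun c ↦ ∀ k, Function.Surjective (Hom.ap (homOf c) k))
    (fun _ _ hc ↦ comparison_map_bijective hφ hc) fun d ↦ by
      obtain ⟨c₀, α, h, h'⟩ := exists_coreflection hφ d
      exact ⟨c₀, α, h, h'⟩

end DeltaF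

end CompositionProduct

theorem mainTheorem9 :
    CompositionProduct.IsCocartesianFibration CompositionProduct.DeltaFDual.proj ∧
      CompositionProduct.IsCategoryObject CompositionProduct.DeltaF.fibre ∧
      CompositionProduct.IsAdmissible CompositionProduct.DeltaF.fibre :=
  ⟨CompositionProduct.isCocartesianFibration_forget _,
    CompositionProduct.DeltaF.isCategoryObject_fibre,
    CompositionProduct.DeltaF.isAdmissible_fibre⟩
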